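/- Let $(X_t)_{t>0}$ be a real square-integrable process on a probability space, with $\mathcal F_{s,u}=\sigma\{X_t:t\in(0,s]\cup[u,\infty)\}$, $\mathcal F_{\le s}=\sigma\{X_t:t\in(0,s]\}$, $\Delta_{s,u}=\frac{X_u-X_s}{u-s}$ and $\widetilde\Delta_{s,u}=\frac{uX_s-sX_u}{u-s}$. Call $(X_t)$ a quadratic harness with parameters $q,\eta,\theta,\sigma,\tau\in\mathbb R$ if $E(X_t)=0$ and $E(X_tX_s)=\min\{t,s\}$ for all $s,t>0$ and if, almost surely, for all $0<s<t<u$, $$E(X_t\mid\mathcal F_{s,u})=\frac{u-t}{u-s}X_s+\frac{t-s}{u-s}X_u,$$ $$\mathrm{Var}(X_t\mid\mathcal F_{s,u})=\frac{(u-t)(t-s)}{u(1+\sigma s)+\tau-qs}\Big(1+\eta\widetilde\Delta_{s,u}+\theta\Delta_{s,u}+\sigma\widetilde\Delta_{s,u}^2+\tau\Delta_{s,u}^2-(1-q)\Delta_{s,u}\widetilde\Delta_{s,u}\Big).$$ **Theorem.** Let $(X_t)_{t>0}$ be a quadratic harness with parameters $q,\eta,\theta,\sigma,\tau$ such that $\sigma,\tau\ge0$,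 $\sigma\tau<1$ and $-1<q\le1-2\sqrt{\sigma\tau}$. Assume that for each $t>0$ the random variable $X_t$ has finite moments of all orders and infinite support. Then there are real sequences $(\alpha_n)_{n\ge0},(\beta_n)_{n\ge0},(\gamma_n)_{n\ge0},(\delta_n)_{n\ge0},(\omega_n)_{n\ge1}$ satisfying (1)–(4) below, and polynomials $p_n(x;t)$ in $x$ ($n\ge0$, $t>0$) with $p_0(x;t)=1$, $p_1(x;t)=x$ and, setting $p_{-1}=0$, $$xp_n(x;t)=a_n(t)p_{n+1}(x;t)+b_n(t)p_n(x;t)+c_n(t)p_{n-1}(x;t),\qquad n\ge0,$$ $$a_n(t)=\sigma\alpha_{n+1}t+\beta_{n+1},\qquad b_n(t)=\gamma_nt+\delta_n,\qquad c_n(t)=(\beta_nt+\tau\alpha_n)\omega_n\ (n\ge1),$$ which are orthogonal martingale polynomials for $(X_t)$. That is, $p_n(x;t)$ has degree exactly $n$; for all $t>0$ one has $E(p_m(X_t;t)p_n(X_t;t))=0$ for $m\ne n$ and $E(p_n(X_t;t)^2)>0$; and $E(p_n(X_t;t)\mid\mathcal F_{\le s})=p_n(X_s;s)$ almost surely for all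 $0<s<t$. Write $\lambda_{n,k}=\beta_n\beta_{n+k}-\sigma\tau\alpha_n\alpha_{n+k}$. 1. $\alpha_0=\beta_0=0$, $\alpha_1=0$, $\beta_1=1$, $\gamma_0=\delta_0=0$, $\omega_1=1$. 2. For $n\ge1$, $$\begin{bmatrix}\alpha_{n+1}\\\beta_{n+1}\end{bmatrix}=\begin{bmatrix}q&1\\-\sigma\tau&1\end{bmatrix}\begin{bmatrix}\alpha_n\\\beta_n\end{bmatrix},$$ and $\lambda_{n,k}>0$ for all $n\ge1$, $k\ge0$. 3. For $n\ge0$ (where $\lambda_{0,2}=0$), $$\gamma_{n+1}=\frac{q+\sigma\tau}{\lambda_{n+2,0}}\big(\lambda_{n,2}\gamma_n+(\alpha_{n+2}\beta_n-\beta_{n+2}\alpha_n)\sigma\delta_n\big)+\frac{\sigma\alpha_{n+2}}{\lambda_{n+2,0}}(\eta\tau\alpha_{n+1}+\theta\beta_{n+1})+\frac{\beta_{n+2}}{\lambda_{n+2,0}}(\theta\sigma\alpha_{n+1}+\eta\beta_{n+1}),$$ $$\delta_{n+1}=\frac{q+\sigma\tau}{\lambda_{n+2,0}}\big(\lambda_{n,2}\delta_n+(\alpha_{n+2}\beta_n-\beta_{n+2}\alpha_n)\tau\gamma_n\big)+\frac{\beta_{n+2}}{\lambda_{n+2,0}}(\eta\tau\alpha_{n+1}+\theta\beta_{n+1})+\frac{\tau\alpha_{n+2}}{\lambda_{n+2,0}}(\theta\sigma\alpha_{n+1}+\eta\beta_{n+1}).$$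 4. $$\omega_2=(1+q)\frac{(1-\sigma\tau)^2+(\eta+\theta\sigma)(\theta+\eta\tau)}{(1-\sigma\tau)^2(1-\sigma\tau(2+q))},$$ and for $n\ge2$ $$\omega_{n+1}=\frac{(q+\sigma\tau)\lambda_{n-1,1}}{\lambda_{n+1,1}}\omega_n+\frac{1+\gamma_n(\tau\gamma_n-\delta_n+\theta)+\delta_n(q\gamma_n+\sigma\delta_n+\eta)}{\lambda_{n+1,1}}.$$ -/

import Mathlib

open MeasureTheory ProbabilityTheory Polynomial

section

variable {Ω : Type*}

/-- The two-sided `σ`-field generated by the `X t` with `t ∈ (0, s] ∪ [u, ∞)`. -/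
def twoSidedField (X : ℝ → Ω → ℝ) (s u : ℝ) : MeasurableSpace Ω :=
  ⨆ t ∈ {t : ℝ | 0 < t ∧ (t ≤ s ∨ u ≤ t)}, MeasurableSpace.comap (X t) inferInstance

/-- The `σ`-field of the past, generated by the `X t` with `t ∈ (0, s]`. -/
def pastField (X : ℝ → Ω → ℝ) (s : ℝ) : MeasurableSpace Ω :=
  ⨆ t ∈ {t : ℝ | 0 < t ∧ t ≤ s}, MeasurableSpace.comap (X t) inferInstance

/-- The difference quotient `(X_u - X_t) / (u - t)`. -/
noncomputable def harnessDelta (X : ℝ → Ω → ℝ) (t u : ℝ) (ω : Ω) : ℝ :=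
  (X u ω - X t ω) / (u - t)

/-- The time-inverted difference quotient `(u X_t - t X_u) / (u - t)`. -/
noncomputable def harnessDeltaTilde (X : ℝ → Ω → ℝ) (t u : ℝ) (ω : Ω) : ℝ :=
  (u * X t ω - t * X u ω) / (u - t)

/-- The normalizing function `F_{t,s,u}` of the conditional variance. -/
noncomputable def harnessF (q σ τ t s u : ℝ) : ℝ :=
  (u - t) * (t - s) / (u * (1 + σ * s) + τ - q * s)

/-- `(X_t)_{t > 0}` is a quadratic harness with parameters `q, η, θ, σ, τ` (only the values
`X t` with `0 < t` matter): a square-integrable process with mean zero and covariance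
`min t s`, with linear regressions and quadratic conditional variances. -/
structure IsQuadraticHarness [MeasurableSpace Ω] (μ : Measure Ω) (X : ℝ → Ω → ℝ)
    (q η θ σ τ : ℝ) : Prop where
  measurable : ∀ t, 0 < t → Measurable (X t)
  memLp_two : ∀ t, 0 < t → MemLp (X t) 2 μ
  mean_eq : ∀ t, 0 < t → ∫ ω, X t ω ∂μ = 0
  cov_eq : ∀ t s, 0 < t → 0 < s → ∫ ω, X t ω * X s ω ∂μ = min t s
  condExp_eq : ∀ s t u, 0 < s → s < t → t < u →
    μ[X t | twoSidedField X s u] =ᵐ[μ]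
      fun ω => (u - t) / (u - s) * X s ω + (t - s) / (u - s) * X u ω
  condVar_eq : ∀ s t u, 0 < s → s < t → t < u →
    Var[X t; μ | twoSidedField X s u] =ᵐ[μ]
      fun ω => harnessF q σ τ t s u *
        (1 + η * harnessDeltaTilde X s u ω + θ * harnessDelta X s u ω
          + σ * harnessDeltaTilde X s u ω ^ 2 + τ * harnessDelta X s u ω ^ 2
          - (1 - q) * harnessDelta X s u ω * harnessDeltaTilde X s u ω)

/-- The polynomials `p_n(x;t)` (written `p n t`), `n ≥ 0`, `t > 0`, are orthogonal martingale
polynomials for `(X_t)_{t > 0}`: `p_n(x;t)` has exact degree `n`, the polynomials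
`p_0(x;t), p_1(x;t), …` are orthogonal with respect to the law of `X_t`, and each
`p_n(X_t;t)` is a martingale in `t`. -/
structure IsOrthogonalMartingalePolynomials [MeasurableSpace Ω] (μ : Measure Ω)
    (X : ℝ → Ω → ℝ) (p : ℕ → ℝ → ℝ[X]) : Prop where
  degree_eq : ∀ n t, 0 < t → (p n t).degree = n
  integrable : ∀ n t, 0 < t → Integrable (fun ω => (p n t).eval (X t ω)) μ
  integrable_mul : ∀ m n t, 0 < t →
    Integrable (fun ω => (p m t).eval (X t ω) * (p n t).eval (X t ω)) μ
  orthogonal : ∀ m n t, 0 < t → m ≠ n →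
    ∫ ω, (p m t).eval (X t ω) * (p n t).eval (X t ω) ∂μ = 0
  norm_pos : ∀ n t, 0 < t → 0 < ∫ ω, (p n t).eval (X t ω) ^ 2 ∂μ
  martingale : ∀ n s t, 0 < s → s < t →
    μ[fun ω => (p n t).eval (X t ω) | pastField X s] =ᵐ[μ] fun ω => (p n s).eval (X s ω)

end

/-- `λ_{n,k} = β_n β_{n+k} - σ τ α_n α_{n+k}`. -/
def lambdaCoeff (σ τ : ℝ) (α β : ℕ → ℝ) (n k : ℕ) : ℝ :=
  β n * β (n + k) - σ * τ * α n * α (n + k)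

/-! The three step recurrence says that the sequence `P n = p_n(v;t)` is an eigenvector, with
eigenvalue `v`, of a tridiagonal matrix `C_t = t x + y`. The recursions for the coefficients give `y
x = q x y + I + θ x + η y + τ x² + σ y²` (`harnessPencil_qCommutes`). Hence the matrices `C_t`
satisfy noncommutative versions of both harness conditions: `C_t` interpolates `C_s` and `C_u`
linearly, and `C_t²` is the quadratic expression in `C_s`, `C_u` that gives `E(X_t² | F_{s,u})`
(`exists_secondMoment_coeffs`).

The martingale property follows by induction on the degree. Let `g j` and `h j` be the conditional
expectations of `p_j(X_t;t)` and `p_j(X_u;u)` given the past of `s`, and `P j = p_j(X_s;s)`. If `g`,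
`h` and `P` agree up to `k + 1`, then computing `E(X_t p_{k+1}(X_u;u) | F_{≤s})` and `E(X_t²
p_k(X_u;u) | F_{≤s})` in two ways gives two linear equations for `g (k + 2)` and `h (k + 2)`. The
values at `P` solve them, and the determinant is nonzero (`eq_succ_of_harness_relations`). The case
of degree one comes from letting `u → ∞` in the linear regression.

For orthogonality, the constant expectations `e` of the martingales satisfy `y e = 0`, because `X_s
→ 0` in `L²` as `s → 0`; this forces `e n = 0` for `n > 0`. Symmetry of multiplication by `X_t`
carries this to the whole Gram matrix (`gram_eq_zero`). -/

/-- The action of a tridiagonal matrix on sequences; the entry `c 0` is meant to vanish. -/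
def tridiagonal (a b c f : ℕ → ℝ) (n : ℕ) : ℝ :=
  a n * f (n + 1) + b n * f n + c n * f (n - 1)

/-! ### Pencils of tridiagonal matrices and the `q`-commutation relation. -/

/-- The coefficients of a pencil `t x + y` of tridiagonal matrices `x` (index `₁`) and `y`
(index `₀`). -/
structure JacobiPencil where
  a₁ : ℕ → ℝ
  b₁ : ℕ → ℝ
  c₁ : ℕ → ℝ
  a₀ : ℕ → ℝ
  b₀ : ℕ → ℝ
  c₀ : ℕ → ℝ

namespace JacobiPencil

/-- The slope `x` of the pencil `t x + y`. -/
def x (J : JacobiPencil) : (ℕ → ℝ) → ℕ → ℝ := tridiagonal J.a₁ J.b₁ J.c₁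

/-- The value `y` at `t = 0` of the pencil `t x + y`. -/
def y (J : JacobiPencil) : (ℕ → ℝ) → ℕ → ℝ := tridiagonal J.a₀ J.b₀ J.c₀

/-- The superdiagonal entries of the matrix `t x + y`. -/
def a (J : JacobiPencil) (t : ℝ) (n : ℕ) : ℝ := J.a₁ n * t + J.a₀ n

/-- The diagonal entries of the matrix `t x + y`. -/
def b (J : JacobiPencil) (t : ℝ) (n : ℕ) : ℝ := J.b₁ n * t + J.b₀ n

/-- The subdiagonal entries of the matrix `t x + y`. -/
def c (J : JacobiPencil) (t : ℝ) (n : ℕ) : ℝ := J.c₁ n * t + J.c₀ n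

/-- The matrix `t x + y`. -/
def mat (J : JacobiPencil) (t : ℝ) : (ℕ → ℝ) → ℕ → ℝ := tridiagonal (J.a t) (J.b t) (J.c t)

/-- The quadratic commutation relation `y x = q x y + I + θ x + η y + τ x² + σ y²`. -/
def QCommutes (J : JacobiPencil) (q η θ σ τ : ℝ) : Prop :=
  ∀ f n, J.y (J.x f) n = q * J.x (J.y f) n + f n + θ * J.x f n + η * J.y f n
    + τ * J.x (J.x f) n + σ * J.y (J.y f) n

lemma mat_apply (J : JacobiPencil) (t : ℝ) (f : ℕ → ℝ) (n : ℕ) :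
    J.mat t f n = t * J.x f n + J.y f n := by
  simp only [mat, x, y, a, b, c, tridiagonal]; ring

lemma mat_mat_apply (J : JacobiPencil) (u s : ℝ) (f : ℕ → ℝ) (n : ℕ) :
    J.mat u (J.mat s f) n = u * s * J.x (J.x f) n + u * J.x (J.y f) n
      + s * J.y (J.x f) n + J.y (J.y f) n := by
  simp only [mat, x, y, a, b, c, tridiagonal]; ring

lemma mat_mul_left (J : JacobiPencil) (u r : ℝ) (f : ℕ → ℝ) (n : ℕ) :
    J.mat u (fun k => r * f k) n = r * J.mat u f n := by
  simp only [mat, tridiagonal]; ring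

lemma mat_interpolate (J : JacobiPencil) {s t u : ℝ} (hsu : s ≠ u) (f : ℕ → ℝ) (n : ℕ) :
    (u - t) / (u - s) * J.mat s f n + (t - s) / (u - s) * J.mat u f n = J.mat t f n := by
  have : u - s ≠ 0 := sub_ne_zero.2 hsu.symm
  simp only [mat_apply]; field_simp; ring

end JacobiPencil

/-- The conditional second moment of a quadratic harness, as a quadratic form with explicit
leading coefficient, and its noncommutative counterpart for a `q`-commuting pencil. -/
lemma exists_secondMoment_coeffs (q η θ σ τ : ℝ) {s t u : ℝ} (hst : s < t) (htu : t < u)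
    (hD : 0 < u * (1 + σ * s) + τ - q * s) :
    ∃ k : Fin 6 → ℝ,
      (∀ v w : ℝ, ((u - t) / (u - s) * v + (t - s) / (u - s) * w) ^ 2 + harnessF q σ τ t s u *
        (1 + η * ((u * v - s * w) / (u - s)) + θ * ((w - v) / (u - s))
          + σ * ((u * v - s * w) / (u - s)) ^ 2 + τ * ((w - v) / (u - s)) ^ 2
          - (1 - q) * ((w - v) / (u - s)) * ((u * v - s * w) / (u - s)))
        = k 0 * v ^ 2 + k 1 * (v * w) + k 2 * w ^ 2 + k 3 * v + k 4 * w + k 5) ∧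
      (∀ J : JacobiPencil, J.QCommutes q η θ σ τ → ∀ f n,
        J.mat t (J.mat t f) n = k 0 * J.mat s (J.mat s f) n + k 1 * J.mat u (J.mat s f) n
          + k 2 * J.mat u (J.mat u f) n + k 3 * J.mat s f n + k 4 * J.mat u f n + k 5 * f n) ∧
      k 2 * (u * (1 + σ * s) + τ - q * s)
        = (t - s) / (u - s) * (t * (1 + σ * s) + τ - q * s) := by
  have hus : u - s ≠ 0 := by linarith
  obtain ⟨D, hDdef⟩ : ∃ D, D = u * (1 + σ * s) + τ - q * s := ⟨_, rfl⟩
  have hD' : D ≠ 0 := hDdef ▸ hD.ne'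
  obtain ⟨F, hF⟩ : ∃ F, F = harnessF q σ τ t s u := ⟨_, rfl⟩
  have hFD : F = (u - t) * (t - s) / D := by rw [hF, harnessF, hDdef]
  rw [← hF, ← hDdef]
  obtain ⟨d, hd⟩ : ∃ d, d = u - s := ⟨_, rfl⟩
  rw [← hd] at hus ⊢
  refine ⟨![((u - t) / d) ^ 2 + F * (σ * u ^ 2 + τ + (1 - q) * u) / d ^ 2,
    2 * ((u - t) / d) * ((t - s) / d) - F * (2 * σ * u * s + 2 * τ + (1 - q) * (u + s)) / d ^ 2,
    ((t - s) / d) ^ 2 + F * (σ * s ^ 2 + τ + (1 - q) * s) / d ^ 2,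
    F * (η * u - θ) / d, F * (θ - η * s) / d, F], ?_, ?_, ?_⟩
  · intro v w
    simp
    field_simp
    ring
  · intro J hJ f n
    -- The commutation relation removes `y x`; the coefficients of `x²`, `x y`, `y²`, `x`, `y` and
    -- `I` then agree one by one. The product `v w` is read as `C_u C_s`, with `C_s` acting first,
    -- since `C_s` is the matrix that will have the eigenvalue `v`.
    simp only [JacobiPencil.mat_mat_apply, hJ f n]
    simp [JacobiPencil.mat_apply, hFD]
    generalize J.x (J.x f) n = xx
    generalize J.x (J.y f) n = xy
    generalize J.y (J.y f) n = yy
    generalize J.x f n = x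
    generalize J.y f n = y
    field_simp
    rw [hDdef, hd]
    ring
  · simp [hFD]
    field_simp
    rw [hDdef, hd]
    ring

/-! ### The coefficient sequences. -/

/-- The sequence `(α_n, β_n)`, with `r` in place of `σ τ`. -/
def alphaBeta (q r : ℝ) : ℕ → ℝ × ℝ
  | 0 => (0, 0)
  | 1 => (0, 1)
  | n + 2 => (q * (alphaBeta q r (n + 1)).1 + (alphaBeta q r (n + 1)).2,
      -r * (alphaBeta q r (n + 1)).1 + (alphaBeta q r (n + 1)).2)

/-- The sequence `(γ_n, δ_n)`. -/
noncomputable def gammaDelta (q η θ σ τ : ℝ) (α β : ℕ → ℝ) : ℕ → ℝ × ℝ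
  | 0 => (0, 0)
  | n + 1 =>
    ((q + σ * τ) / lambdaCoeff σ τ α β (n + 2) 0 *
        (lambdaCoeff σ τ α β n 2 * (gammaDelta q η θ σ τ α β n).1
          + (α (n + 2) * β n - β (n + 2) * α n) * σ * (gammaDelta q η θ σ τ α β n).2)
      + σ * α (n + 2) / lambdaCoeff σ τ α β (n + 2) 0 *
        (η * τ * α (n + 1) + θ * β (n + 1))
      + β (n + 2) / lambdaCoeff σ τ α β (n + 2) 0 *
        (θ * σ * α (n + 1) + η * β (n + 1)),
     (q + σ * τ) / lambdaCoeff σ τ α β (n + 2) 0 *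
        (lambdaCoeff σ τ α β n 2 * (gammaDelta q η θ σ τ α β n).2
          + (α (n + 2) * β n - β (n + 2) * α n) * τ * (gammaDelta q η θ σ τ α β n).1)
      + β (n + 2) / lambdaCoeff σ τ α β (n + 2) 0 *
        (η * τ * α (n + 1) + θ * β (n + 1))
      + τ * α (n + 2) / lambdaCoeff σ τ α β (n + 2) 0 *
        (θ * σ * α (n + 1) + η * β (n + 1)))

/-- The sequence `ω_n`; the value at `0` is irrelevant. -/
noncomputable def omegaSeq (q η θ σ τ : ℝ) (α β γ δ : ℕ → ℝ) : ℕ → ℝ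
  | 0 => 0
  | 1 => 1
  | 2 => (1 + q) * (((1 - σ * τ) ^ 2 + (η + θ * σ) * (θ + η * τ)) /
          ((1 - σ * τ) ^ 2 * (1 - σ * τ * (2 + q))))
  | n + 3 => (q + σ * τ) * lambdaCoeff σ τ α β (n + 1) 1 / lambdaCoeff σ τ α β (n + 3) 1
        * omegaSeq q η θ σ τ α β γ δ (n + 2)
      + (1 + γ (n + 2) * (τ * γ (n + 2) - δ (n + 2) + θ)
        + δ (n + 2) * (q * γ (n + 2) + σ * δ (n + 2) + η)) / lambdaCoeff σ τ α β (n + 3) 1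

/-! ### Positivity of the coefficients. -/

section Positivity

variable {q r : ℝ} {α β : ℕ → ℝ}

/-- The recurrence for `(α_n, β_n)` preserves the cone `α ≥ 0`, `β > r α`. -/
lemma alpha_nonneg_and_lt_beta (hr : 0 ≤ r) (hr1 : r < 1) (hq : -1 < q) (hq' : q ≤ 1 - 2 * r)
    (hα1 : α 1 = 0) (hβ1 : β 1 = 1)
    (hα : ∀ n, 1 ≤ n → α (n + 1) = q * α n + β n)
    (hβ : ∀ n, 1 ≤ n → β (n + 1) = -r ^ 2 * α n + β n) (n : ℕ) (hn : 1 ≤ n) :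
    0 ≤ α n ∧ 0 ≤ α (n + 1) ∧ r * α n < β n := by
  induction n, hn using Nat.le_induction with
  | base => simp [hα1, hβ1, hα 1 le_rfl]
  | succ n hn ih =>
    obtain ⟨h0, h1, h2⟩ := ih
    have hlt : r * α (n + 1) < β (n + 1) := by
      rw [hα n hn, hβ n hn]
      -- The difference of the two sides is `(1 - r) (β n - r α n) + r (1 - 2 r - q) α n`.
      nlinarith [mul_nonneg (mul_nonneg hr h0) (sub_nonneg.2 hq'), mul_pos (sub_pos.2 hr1)
        (sub_pos.2 h2)]
    refine ⟨h1, ?_, hlt⟩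
    -- If `q + r² ≤ 0`, use `α (n + 2) = (1 + q) α (n + 1) - (q + r²) α n`; otherwise `q + r ≥ q +
    -- r² ≥ 0` and `α (n + 2) ≥ (q + r) α (n + 1)`.
    rcases le_total (q + r ^ 2) 0 with h | h
    · rw [hα (n + 1) (by omega), hβ n hn]
      have : β n = α (n + 1) - q * α n := by rw [hα n hn]; ring
      rw [this]
      nlinarith [mul_nonneg (neg_nonneg.2 h) h0, mul_nonneg (neg_le_iff_add_nonneg'.1 hq.le) h1]
    · rw [hα (n + 1) (by omega)]
      have : 0 ≤ q + r := by nlinarith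
      nlinarith [mul_nonneg this h1]

lemma beta_pos_of_lt (hr : 0 ≤ r) {n : ℕ} (h0 : 0 ≤ α n) (h : r * α n < β n) : 0 < β n :=
  (mul_nonneg hr h0).trans_lt h

/-- Multiply the inequalities `r α < β` at the indices `n` and `n + k`. -/
lemma lambdaCoeff_pos_of_lt {σ τ : ℝ} (hr : 0 ≤ r) (hστ : σ * τ = r ^ 2)
    (h : ∀ n, 1 ≤ n → 0 ≤ α n ∧ r * α n < β n) (n k : ℕ) (hn : 1 ≤ n) :
    0 < lambdaCoeff σ τ α β n k := by
  have h1 := h n hn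
  have h2 := h (n + k) (by omega)
  have := mul_lt_mul'' h1.2 h2.2 (mul_nonneg hr h1.1) (mul_nonneg hr h2.1)
  rw [lambdaCoeff, hστ]
  linarith

end Positivity

/-! ### The recursions imply `q`-commutation. -/

section Commutation

variable {q η θ σ τ : ℝ} {α β γ δ ω : ℕ → ℝ}

/-- The recursions for `γ` and `δ` are Cramer's rule for this `2 × 2` system, whose determinant is
`λ_{n+2,0}`. The commutation relation needs the system itself. -/
lemma gamma_delta_relations (hα0 : α 0 = 0) (hβ0 : β 0 = 0) (hγ0 : γ 0 = 0) (hδ0 : δ 0 = 0)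
    (hα : ∀ n, 1 ≤ n → α (n + 1) = q * α n + β n)
    (hβ : ∀ n, 1 ≤ n → β (n + 1) = -(σ * τ) * α n + β n)
    (hlam : ∀ n, lambdaCoeff σ τ α β (n + 2) 0 ≠ 0)
    (hγ : ∀ n, γ (n + 1) =
          (q + σ * τ) / lambdaCoeff σ τ α β (n + 2) 0 *
            (lambdaCoeff σ τ α β n 2 * γ n
              + (α (n + 2) * β n - β (n + 2) * α n) * σ * δ n)
          + σ * α (n + 2) / lambdaCoeff σ τ α β (n + 2) 0 *
            (η * τ * α (n + 1) + θ * β (n + 1))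
          + β (n + 2) / lambdaCoeff σ τ α β (n + 2) 0 *
            (θ * σ * α (n + 1) + η * β (n + 1)))
    (hδ : ∀ n, δ (n + 1) =
          (q + σ * τ) / lambdaCoeff σ τ α β (n + 2) 0 *
            (lambdaCoeff σ τ α β n 2 * δ n
              + (α (n + 2) * β n - β (n + 2) * α n) * τ * γ n)
          + β (n + 2) / lambdaCoeff σ τ α β (n + 2) 0 *
            (η * τ * α (n + 1) + θ * β (n + 1))
          + τ * α (n + 2) / lambdaCoeff σ τ α β (n + 2) 0 *
            (θ * σ * α (n + 1) + η * β (n + 1))) (n : ℕ) :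
    β (n + 2) * γ (n + 1) - σ * α (n + 2) * δ (n + 1)
        = θ * σ * α (n + 1) + η * β (n + 1) + γ n * (q * β (n + 1) + σ * τ * α (n + 1))
          + σ * δ n * (β (n + 1) - α (n + 1)) ∧
    β (n + 2) * δ (n + 1) - τ * α (n + 2) * γ (n + 1)
        = θ * β (n + 1) + η * τ * α (n + 1) + δ n * (q * β (n + 1) + σ * τ * α (n + 1))
          + τ * γ n * (β (n + 1) - α (n + 1)) := by
  obtain ⟨l, hl⟩ : ∃ l, l = lambdaCoeff σ τ α β (n + 2) 0 := ⟨_, rfl⟩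
  have hl0 : l ≠ 0 := hl ▸ hlam n
  have hl' : l = β (n + 2) * β (n + 2) - σ * τ * α (n + 2) * α (n + 2) := hl
  obtain ⟨R, hR⟩ : ∃ R, R = θ * σ * α (n + 1) + η * β (n + 1)
    + γ n * (q * β (n + 1) + σ * τ * α (n + 1)) + σ * δ n * (β (n + 1) - α (n + 1)) := ⟨_, rfl⟩
  obtain ⟨S, hS⟩ : ∃ S, S = θ * β (n + 1) + η * τ * α (n + 1)
    + δ n * (q * β (n + 1) + σ * τ * α (n + 1)) + τ * γ n * (β (n + 1) - α (n + 1)) := ⟨_, rfl⟩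
  have hγl : γ (n + 1) = (β (n + 2) * R + σ * α (n + 2) * S) / l := by
    rw [hγ n, ← hl, hR, hS, lambdaCoeff]
    rcases Nat.eq_zero_or_pos n with rfl | hn
    · simp only [hα0, hβ0, hγ0, hδ0]; field_simp; ring
    · rw [hα n hn, hβ n hn]; field_simp; ring
  have hδl : δ (n + 1) = (β (n + 2) * S + τ * α (n + 2) * R) / l := by
    rw [hδ n, ← hl, hR, hS, lambdaCoeff]
    rcases Nat.eq_zero_or_pos n with rfl | hn
    · simp only [hα0, hβ0, hγ0, hδ0]; field_simp; ring
    · rw [hα n hn, hβ n hn]; field_simp; ring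
  rw [hγl, hδl, ← hR, ← hS]
  constructor
  · field_simp; rw [hl']; ring
  · field_simp; rw [hl']; ring

/-- A single form of the recursion that includes `n = 1`. The fraction-free coefficient of `ω n`
equals `(q + σ τ) λ_{n-1,1}` only for `n ≥ 2`, because the recurrence for `α`, `β` does not hold
from `0` to `1`; this is why `ω 2` is prescribed separately. -/
lemma omega_relation (hα1 : α 1 = 0) (hβ1 : β 1 = 1) (hω1 : ω 1 = 1)
    (hω2 : ω 2 = (1 + q) * (((1 - σ * τ) ^ 2 + (η + θ * σ) * (θ + η * τ)) /
          ((1 - σ * τ) ^ 2 * (1 - σ * τ * (2 + q)))))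
    (hγδ : β 2 * γ 1 - σ * α 2 * δ 1 = η ∧ β 2 * δ 1 - τ * α 2 * γ 1 = θ)
    (hα : ∀ n, 1 ≤ n → α (n + 1) = q * α n + β n)
    (hβ : ∀ n, 1 ≤ n → β (n + 1) = -(σ * τ) * α n + β n)
    (hστ : σ * τ ≠ 1)
    (hlam : ∀ n, lambdaCoeff σ τ α β (n + 2) 1 ≠ 0)
    (hω : ∀ n, 2 ≤ n → ω (n + 1) =
          (q + σ * τ) * lambdaCoeff σ τ α β (n - 1) 1 / lambdaCoeff σ τ α β (n + 1) 1 * ω n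
          + (1 + γ n * (τ * γ n - δ n + θ) + δ n * (q * γ n + σ * δ n + η)) /
            lambdaCoeff σ τ α β (n + 1) 1) (n : ℕ) (hn : 1 ≤ n) :
    ω (n + 1) * lambdaCoeff σ τ α β (n + 1) 1
      = ω n * (q * β n ^ 2 - σ * τ * α n ^ 2 + 2 * (σ * τ) * α n * β n)
        + (1 + γ n * (τ * γ n - δ n + θ) + δ n * (q * γ n + σ * δ n + η)) := by
  have hl := hlam (n - 1)
  rw [show n - 1 + 2 = n + 1 by omega] at hl
  rcases hn.eq_or_lt with rfl | hn
  · have hα2 : α 2 = 1 := by rw [hα 1 le_rfl, hα1, hβ1]; ring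
    have hβ2 : β 2 = 1 := by rw [hβ 1 le_rfl, hα1, hβ1]; ring
    have hα3 : α 3 = q + 1 := by rw [hα 2 (by norm_num), hα2, hβ2]; ring
    have hβ3 : β 3 = 1 - σ * τ := by rw [hβ 2 (by norm_num), hα2, hβ2]; ring
    have hl2 : lambdaCoeff σ τ α β (1 + 1) 1 = 1 - σ * τ * (2 + q) := by
      simp only [lambdaCoeff, Nat.reduceAdd, hα2, hβ2, hα3, hβ3]; ring
    rw [hl2] at hl ⊢
    have h1 : 1 - σ * τ ≠ 0 := sub_ne_zero.2 (Ne.symm hστ)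
    obtain ⟨hη, hθ⟩ := hγδ
    rw [hα2, hβ2] at hη hθ
    -- Here `η + θ σ = (1 - σ τ) γ 1` and `θ + η τ = (1 - σ τ) δ 1`, so that `ω 2 = (1 + q) (1 + γ 1
    -- δ 1) / (1 - σ τ (2 + q))`.
    simp only [Nat.reduceAdd, hω2, hω1, hα1, hβ1, ← hη, ← hθ]
    field_simp
    ring
  · obtain ⟨m, rfl⟩ : ∃ m, n = m + 2 := ⟨n - 2, by omega⟩
    rw [hω _ hn]
    have : (q + σ * τ) * lambdaCoeff σ τ α β (m + 2 - 1) 1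
        = q * β (m + 2) ^ 2 - σ * τ * α (m + 2) ^ 2 + 2 * (σ * τ) * α (m + 2) * β (m + 2) := by
      simp only [lambdaCoeff, Nat.add_one_sub_one]
      rw [hα (m + 1) (by omega), hβ (m + 1) (by omega)]; ring
    rw [this]
    field_simp

/-- The pencil of the three step recurrence. -/
def harnessPencil (σ τ : ℝ) (α β γ δ ω : ℕ → ℝ) : JacobiPencil where
  a₁ n := σ * α (n + 1)
  b₁ := γ
  c₁ n := β n * ω n
  a₀ n := β (n + 1)
  b₀ := δ
  c₀ n := τ * α n * ω n

/-- Coefficients are compared in row `n`. For `n ≥ 1` those of `f (n + 2)`, `f (n + 1)`, `f n`, `f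
(n - 1)`, `f (n - 2)` vanish by `h5`, `h1`, `h3`, `h2`, `h4` respectively. In row `0` the identity
term comes from `ω 1 = 1`. -/
lemma harnessPencil_qCommutes (hα0 : α 0 = 0) (hβ0 : β 0 = 0) (hα1 : α 1 = 0) (hβ1 : β 1 = 1)
    (hγ0 : γ 0 = 0) (hδ0 : δ 0 = 0) (hω1 : ω 1 = 1)
    (hα : ∀ n, 1 ≤ n → α (n + 1) = q * α n + β n)
    (hβ : ∀ n, 1 ≤ n → β (n + 1) = -(σ * τ) * α n + β n)
    (hγδ : ∀ n, β (n + 2) * γ (n + 1) - σ * α (n + 2) * δ (n + 1)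
        = θ * σ * α (n + 1) + η * β (n + 1) + γ n * (q * β (n + 1) + σ * τ * α (n + 1))
          + σ * δ n * (β (n + 1) - α (n + 1)) ∧
      β (n + 2) * δ (n + 1) - τ * α (n + 2) * γ (n + 1)
        = θ * β (n + 1) + η * τ * α (n + 1) + δ n * (q * β (n + 1) + σ * τ * α (n + 1))
          + τ * γ n * (β (n + 1) - α (n + 1)))
    (hω : ∀ n, 1 ≤ n → ω (n + 1) * lambdaCoeff σ τ α β (n + 1) 1
      = ω n * (q * β n ^ 2 - σ * τ * α n ^ 2 + 2 * (σ * τ) * α n * β n)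
        + (1 + γ n * (τ * γ n - δ n + θ) + δ n * (q * γ n + σ * δ n + η))) :
    (harnessPencil σ τ α β γ δ ω).QCommutes q η θ σ τ := by
  intro f n
  simp only [JacobiPencil.x, JacobiPencil.y, harnessPencil, tridiagonal]
  have hA := hα (n + 1) (by omega)
  have hB := hβ (n + 1) (by omega)
  obtain ⟨h1, -⟩ := hγδ n
  rcases n with _ | m
  · simp only [hα0, hβ0, hα1, hβ1, hγ0, hδ0, hω1, zero_add] at hA hB h1 ⊢
    simp only [Nat.reduceAdd] at hA hB h1 ⊢
    rw [hA, hB] at h1 ⊢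
    linear_combination f 1 * h1
  · obtain ⟨-, h2⟩ := hγδ m
    have h3 := hω (m + 1) (by omega)
    simp only [lambdaCoeff] at h3
    simp only [Nat.add_one_sub_one, add_assoc, Nat.reduceAdd] at hA hB h1 h2 h3 ⊢
    have h4 : α (m + 1) * β m - q * β (m + 1) * α m - β (m + 1) * β m
        - σ * τ * α (m + 1) * α m = 0 := by
      rcases Nat.eq_zero_or_pos m with rfl | hm
      · simp [hα0, hβ0]
      · rw [hα m hm, hβ m hm]; ring
    have h5 : β (m + 2) * α (m + 3) - q * α (m + 2) * β (m + 3) - β (m + 2) * β (m + 3)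
        - σ * τ * α (m + 2) * α (m + 3) = 0 := by
      rw [hA, hB]; ring
    rw [hA, hB] at h1 h3
    have hA' := hα (m + 1) (by omega)
    have hB' := hβ (m + 1) (by omega)
    simp only [add_assoc, Nat.reduceAdd] at hA' hB'
    linear_combination f (m + 3) * σ * h5 + f (m + 2) * h1 + f (m + 1) * h3
      + f m * ω (m + 1) * (h2 + γ (m + 1) * τ * hA' - δ (m + 1) * hB')
      + τ * ω (m + 1) * ω m * f (m - 1) * h4

end Commutation

/-! ### Polynomials of a pencil, and the linear algebra of their expectations. -/

section Pencil

namespace JacobiPencil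

variable (J : JacobiPencil)

/-- The polynomials defined by the three step recurrence of the pencil. -/
noncomputable def poly (t : ℝ) : ℕ → ℝ[X]
  | 0 => 1
  | 1 => C (J.a t 0)⁻¹ * (X - C (J.b t 0))
  | n + 2 => C (J.a t (n + 1))⁻¹ *
      (X * poly t (n + 1) - C (J.b t (n + 1)) * poly t (n + 1) - C (J.c t (n + 1)) * poly t n)

variable {J}

lemma X_mul_poly_zero {t : ℝ} (ha : J.a t 0 ≠ 0) :
    X * J.poly t 0 = C (J.a t 0) * J.poly t 1 + C (J.b t 0) * J.poly t 0 := by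
  rw [poly, poly, ← mul_assoc, ← C_mul, mul_inv_cancel₀ ha, C_1]; ring

lemma X_mul_poly_succ {t : ℝ} {n : ℕ} (ha : J.a t (n + 1) ≠ 0) :
    X * J.poly t (n + 1) = C (J.a t (n + 1)) * J.poly t (n + 2)
      + C (J.b t (n + 1)) * J.poly t (n + 1) + C (J.c t (n + 1)) * J.poly t n := by
  rw [poly, ← mul_assoc, ← C_mul, mul_inv_cancel₀ ha, C_1]; ring

/-- The eigenvector equation. In row `0` the truncated index `0 - 1 = 0` is harmless because `J.c t
0 = 0`. -/
lemma mul_eval_poly {t : ℝ} (ha : ∀ n, J.a t n ≠ 0) (hc : J.c t 0 = 0) (v : ℝ) (n : ℕ) :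
    v * (J.poly t n).eval v = J.mat t (fun k => (J.poly t k).eval v) n := by
  rcases n with _ | n
  · simpa [mat, tridiagonal, hc] using congrArg (eval v) (X_mul_poly_zero (ha 0))
  · simpa [mat, tridiagonal] using congrArg (eval v) (X_mul_poly_succ (ha (n + 1)))

lemma degree_poly {t : ℝ} (ha : ∀ n, J.a t n ≠ 0) (n : ℕ) : (J.poly t n).degree = n := by
  induction n using Nat.strong_induction_on with
  | _ n ih =>
    rcases n with _ | _ | n
    · simp [poly]
    · rw [poly, degree_C_mul (inv_ne_zero (ha 0)), degree_X_sub_C]; rfl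
    · have h1 := ih (n + 1) (by omega)
      have h0 := ih n (by omega)
      rw [poly, degree_C_mul (inv_ne_zero (ha _))]
      have hX : (X * J.poly t (n + 1)).degree = ((n + 2 : ℕ) : WithBot ℕ) := by
        rw [degree_mul, degree_X, h1, ← Nat.cast_one, ← Nat.cast_add]
        congr 1; omega
      have hb : (C (J.b t (n + 1)) * J.poly t (n + 1)).degree < ((n + 2 : ℕ) : WithBot ℕ) := by
        rw [← smul_eq_C_mul]
        refine (degree_smul_le _ _).trans_lt ?_
        rw [h1]; exact_mod_cast Nat.lt_succ_self _
      have hc : (C (J.c t (n + 1)) * J.poly t n).degree < ((n + 2 : ℕ) : WithBot ℕ) := by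
        rw [← smul_eq_C_mul]
        refine (degree_smul_le _ _).trans_lt ?_
        rw [h0]; exact_mod_cast (by omega : n < n + 2)
      rw [degree_sub_eq_left_of_degree_lt, degree_sub_eq_left_of_degree_lt, hX]
      · rwa [hX]
      · rw [degree_sub_eq_left_of_degree_lt, hX]
        · exact hc
        · rwa [hX]

/-- A sequence that agrees with a solution `P` of the recurrence up to index `k + 1` agrees with it
at `k + 2` if it satisfies the relations that express linearity of regression and the quadratic
conditional variance. -/
lemma eq_succ_of_harness_relations {q σ τ s t u v : ℝ} {κ : Fin 6 → ℝ} {P g h : ℕ → ℝ} {k : ℕ}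
    (hst : s < t) (htu : t < u)
    (hmat : ∀ f n, J.mat t (J.mat t f) n = κ 0 * J.mat s (J.mat s f) n
      + κ 1 * J.mat u (J.mat s f) n + κ 2 * J.mat u (J.mat u f) n + κ 3 * J.mat s f n
      + κ 4 * J.mat u f n + κ 5 * f n)
    (hκ : κ 2 * (u * (1 + σ * s) + τ - q * s)
        = (t - s) / (u - s) * (t * (1 + σ * s) + τ - q * s))
    (hP : ∀ n, v * P n = J.mat s P n)
    (hg : ∀ j ≤ k + 1, g j = P j) (hh : ∀ j ≤ k + 1, h j = P j)
    (hat : J.a t (k + 1) ≠ 0)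
    (hdet : J.a₀ k * (1 + σ * s) - J.a₁ k * (τ - q * s) ≠ 0)
    (h1 : J.mat t g (k + 1)
      = (u - t) / (u - s) * (v * P (k + 1)) + (t - s) / (u - s) * J.mat u h (k + 1))
    (h2 : J.mat t (J.mat t g) k = κ 0 * (v ^ 2 * P k) + κ 1 * (v * J.mat u h k)
      + κ 2 * J.mat u (J.mat u h) k + κ 3 * (v * P k) + κ 4 * J.mat u h k + κ 5 * P k) :
    g (k + 2) = P (k + 2) := by
  -- The entry `k + 2`, where `f` may first differ from `P`, enters row `k + 1` of one matrix and
  -- row `k` of its square linearly.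
  have key1 : ∀ r (f : ℕ → ℝ), (∀ j ≤ k + 1, f j = P j) →
      J.mat r f (k + 1) = J.mat r P (k + 1) + J.a r (k + 1) * (f (k + 2) - P (k + 2)) := by
    intro r f hf
    simp only [mat, tridiagonal, hf (k + 1) le_rfl, hf (k + 1 - 1) (by omega)]; ring
  have key0 : ∀ r (f : ℕ → ℝ), (∀ j ≤ k + 1, f j = P j) → ∀ j ≤ k, J.mat r f j = J.mat r P j := by
    intro r f hf j hj
    simp only [mat, tridiagonal, hf (j + 1) (by omega), hf (j - 1) (by omega), hf j (by omega)]
  have key2 : ∀ r (f : ℕ → ℝ), (∀ j ≤ k + 1, f j = P j) →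
      J.mat r (J.mat r f) k = J.mat r (J.mat r P) k
        + J.a r k * J.a r (k + 1) * (f (k + 2) - P (k + 2)) := by
    intro r f hf
    have hP' : J.mat r (J.mat r P) k = J.a r k * J.mat r P (k + 1) + J.b r k * J.mat r P k
      + J.c r k * J.mat r P (k - 1) := rfl
    have hf' : J.mat r (J.mat r f) k = J.a r k * J.mat r f (k + 1) + J.b r k * J.mat r f k
      + J.c r k * J.mat r f (k - 1) := rfl
    rw [hf', hP', key1 r f hf, key0 r f hf k le_rfl, key0 r f hf (k - 1) (by omega)]
    ring
  have hPfun : J.mat s P = fun n => v * P n := funext fun n => (hP n).symm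
  have hss : J.mat s (J.mat s P) k = v ^ 2 * P k := by
    rw [hPfun, mat_mul_left, ← hP]; ring
  have hus : J.mat u (J.mat s P) k = v * J.mat u P k := by
    rw [hPfun, mat_mul_left]
  rw [key1 t g hg, key1 u h hh, hP, ← J.mat_interpolate (t := t) (hst.trans htu).ne P] at h1
  rw [key2 t g hg, key2 u h hh, key0 u h hh k le_rfl, hmat, hss, hus, hP k] at h2
  have hd : 0 < u - s := by linarith
  have e1 : J.a t (k + 1) * (g (k + 2) - P (k + 2))
      = (t - s) / (u - s) * (J.a u (k + 1) * (h (k + 2) - P (k + 2))) := by linarith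
  have e2 : J.a t k * (J.a t (k + 1) * (g (k + 2) - P (k + 2)))
      = κ 2 * J.a u k * (J.a u (k + 1) * (h (k + 2) - P (k + 2))) := by linarith
  rw [e1] at e2
  -- Eliminating `g (k + 2) - P (k + 2)` leaves a multiple of `h (k + 2) - P (k + 2)`. By `hκ`,
  -- clearing the denominator of `κ 2` makes the determinant factor, with `u - t` and the quantity
  -- of `hdet` as factors.
  have e3 : (t - s) / (u - s) * ((u - t) * (J.a₀ k * (1 + σ * s) - J.a₁ k * (τ - q * s)))
      * (J.a u (k + 1) * (h (k + 2) - P (k + 2))) = 0 := by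
    simp only [a] at e2 ⊢
    linear_combination (u * (1 + σ * s) + τ - q * s) * e2
      + (J.a₁ k * u + J.a₀ k) * ((J.a₁ (k + 1) * u + J.a₀ (k + 1)) * (h (k + 2) - P (k + 2))) * hκ
  have hne : (t - s) / (u - s) * ((u - t) * (J.a₀ k * (1 + σ * s) - J.a₁ k * (τ - q * s))) ≠ 0 :=
    mul_ne_zero (div_ne_zero (by linarith) hd.ne') (mul_ne_zero (by linarith) hdet)
  rw [(mul_eq_zero.1 e3).resolve_left hne, mul_zero] at e1
  exact sub_eq_zero.1 ((mul_eq_zero.1 e1).resolve_left hat)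

/-- Orthogonality from the three step recurrence, in terms of the Gram matrix `M`. -/
lemma gram_eq_zero {t : ℝ} {M : ℕ → ℕ → ℝ} (ha : ∀ n, J.a t n ≠ 0)
    (h0 : ∀ n, 0 < n → M 0 n = 0)
    (hM : ∀ m n, J.mat t (fun k => M k n) m = J.mat t (M m) n) (m n : ℕ) (hmn : m < n) :
    M m n = 0 := by
  induction m using Nat.strong_induction_on generalizing n with
  | _ m ih =>
    rcases m with _ | m
    · exact h0 n hmn
    · have h := hM m n
      simp only [mat, tridiagonal] at h
      rw [ih m (by omega) n (by omega), ih (m - 1) (by omega) n (by omega),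
        ih m (by omega) (n + 1) (by omega), ih m (by omega) (n - 1) (by omega)] at h
      simpa [ha m] using h

/-- The expectations are determined by the matrix `y`. -/
lemma eq_zero_of_y_eq_zero {e : ℕ → ℝ} (hb0 : J.b₀ 0 = 0) (hc0 : J.c₀ 0 = 0) (hc1 : J.c₀ 1 = 0)
    (ha : ∀ n, J.a₀ n ≠ 0) (hy : ∀ n, J.y e n = 0) (n : ℕ) (hn : 0 < n) : e n = 0 := by
  induction n using Nat.strong_induction_on with
  | _ n ih =>
    obtain ⟨n, rfl⟩ := Nat.exists_eq_succ_of_ne_zero hn.ne'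
    have h := hy n
    simp only [y, tridiagonal] at h
    -- Only `e 0` is unconstrained, and it drops out since `b₀ 0`, `c₀ 0` and `c₀ 1` vanish.
    rcases n with _ | _ | n
    · simpa [hb0, hc0, ha 0] using h
    · rw [ih 1 (by omega) (by omega)] at h
      simpa [hc1, ha 1] using h
    · rw [ih (n + 2) (by omega) (by omega), ih (n + 2 - 1) (by omega) (by omega)] at h
      simpa [ha (n + 2)] using h

end JacobiPencil

end Pencil

/-! ### Moments and conditional expectations. -/

section Moments

variable {Ω : Type*} {mΩ : MeasurableSpace Ω} {μ : Measure Ω}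

/-- All absolute moments of `f` are finite. -/
def HasAllMoments (f : Ω → ℝ) (μ : Measure Ω) : Prop := ∀ p : ℕ, MemLp f p μ

namespace HasAllMoments

variable {f g : Ω → ℝ}

lemma integrable (hf : HasAllMoments f μ) : Integrable f μ := by
  rw [← memLp_one_iff_integrable]; exact_mod_cast hf 1

lemma add (hf : HasAllMoments f μ) (hg : HasAllMoments g μ) :
    HasAllMoments (fun ω => f ω + g ω) μ := fun p => (hf p).add (hg p)

lemma const_mul (hf : HasAllMoments f μ) (c : ℝ) : HasAllMoments (fun ω => c * f ω) μ :=
  fun p => (hf p).const_mul c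

lemma const [IsFiniteMeasure μ] (c : ℝ) : HasAllMoments (fun _ : Ω => c) μ :=
  fun _ => memLp_const c

lemma mul (hf : HasAllMoments f μ) (hg : HasAllMoments g μ) :
    HasAllMoments (fun ω => f ω * g ω) μ := by
  intro p
  have : ENNReal.HolderTriple ((2 * p : ℕ) : ENNReal) ((2 * p : ℕ) : ENNReal) (p : ENNReal) := by
    constructor
    push_cast
    rw [ENNReal.mul_inv (by simp) (by simp), ← add_mul, ENNReal.inv_two_add_inv_two, one_mul]
  exact (hg (2 * p)).mul' (hf (2 * p))

lemma pow [IsFiniteMeasure μ] (hf : HasAllMoments f μ) (n : ℕ) :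
    HasAllMoments (fun ω => f ω ^ n) μ := by
  induction n with
  | zero => simpa using const 1
  | succ n ih => simpa only [pow_succ] using ih.mul hf

lemma eval [IsFiniteMeasure μ] (hf : HasAllMoments f μ) (p : ℝ[X]) :
    HasAllMoments (fun ω => p.eval (f ω)) μ := by
  induction p using Polynomial.induction_on' with
  | add p r hp hr => simpa using hp.add hr
  | monomial n a => simpa using (hf.pow n).const_mul a

lemma of_integrable_pow [IsFiniteMeasure μ] (hf : AEStronglyMeasurable f μ)
    (h : ∀ n : ℕ, Integrable (fun ω => f ω ^ n) μ) : HasAllMoments f μ := by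
  intro p
  -- An even exponent turns integrability of a power into that of an absolute power; the `+ 1` keeps
  -- it nonzero when `p = 0`.
  have hp : MemLp f ((2 * (p + 1) : ℕ) : ENNReal) μ := by
    rw [← integrable_norm_rpow_iff hf (by simp) (ENNReal.natCast_ne_top _)]
    refine (h (2 * (p + 1))).congr (ae_of_all _ fun ω => ?_)
    dsimp only
    rw [ENNReal.toReal_natCast, Real.rpow_natCast, Real.norm_eq_abs, pow_mul, pow_mul, sq_abs]
  exact hp.mono_exponent (by exact_mod_cast (by omega))

end HasAllMoments

lemma condExp_lincomb_three {m : MeasurableSpace Ω} {f g h : Ω → ℝ} (hf : Integrable f μ)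
    (hg : Integrable g μ) (hh : Integrable h μ) (a b c : ℝ) :
    μ[fun ω => a * f ω + b * g ω + c * h ω | m]
      =ᵐ[μ] fun ω => a * (μ[f | m]) ω + b * (μ[g | m]) ω + c * (μ[h | m]) ω := by
  have h1 := condExp_add ((hf.const_mul a).add (hg.const_mul b)) (hh.const_mul c) m
  have h2 := condExp_add (hf.const_mul a) (hg.const_mul b) m
  have e1 : μ[fun ω => a * f ω | m] =ᵐ[μ] a • μ[f | m] := condExp_smul a f m
  have e2 : μ[fun ω => b * g ω | m] =ᵐ[μ] b • μ[g | m] := condExp_smul b g m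
  have e3 : μ[fun ω => c * h ω | m] =ᵐ[μ] c • μ[h | m] := condExp_smul c h m
  filter_upwards [h1, h2, e1, e2, e3] with ω h1 h2 e1 e2 e3
  refine h1.trans ?_
  rw [Pi.add_apply, h2, Pi.add_apply, e1, e2, e3]
  rfl

lemma condExp_tridiagonal {m : MeasurableSpace Ω} {F : ℕ → Ω → ℝ} (hF : ∀ k, Integrable (F k) μ)
    (a b c : ℕ → ℝ) (n : ℕ) :
    μ[fun ω => tridiagonal a b c (fun k => F k ω) n | m]
      =ᵐ[μ] fun ω => tridiagonal a b c (fun k => (μ[F k | m]) ω) n :=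
  condExp_lincomb_three (hF _) (hF _) (hF _) _ _ _

end Moments

/-- Replacing a factor by its conditional expectation with respect to a larger `σ`-field. -/
lemma condExp_mul_congr {Ω : Type*} {m m' mΩ : MeasurableSpace Ω} {μ : Measure Ω} (hm : m ≤ m') (hm' : m' ≤ mΩ)
    [IsFiniteMeasure μ] {Y Z g : Ω → ℝ}
    (hYZ : μ[Y | m'] =ᵐ[μ] Z) (hg : StronglyMeasurable[m'] g)
    (hYg : Integrable (fun ω => Y ω * g ω) μ) (hY : Integrable Y μ) :
    μ[fun ω => Y ω * g ω | m] =ᵐ[μ] μ[fun ω => Z ω * g ω | m] := by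
  have h1 : μ[fun ω => Y ω * g ω | m'] =ᵐ[μ] fun ω => Z ω * g ω := by
    refine (condExp_mul_of_stronglyMeasurable_right hg hYg hY).trans ?_
    filter_upwards [hYZ] with ω h
    rw [Pi.mul_apply, h]
  exact (condExp_condExp_of_le hm hm').symm.trans (condExp_congr_ae h1)

/-! ### The `σ`-fields of the process. -/

section Fields

variable {Ω : Type*} {mΩ : MeasurableSpace Ω} {X : ℝ → Ω → ℝ}

lemma pastField_le (hX : ∀ t, 0 < t → Measurable (X t)) (s : ℝ) : pastField X s ≤ mΩ :=
  iSup₂_le fun t ht => (hX t ht.1).comap_le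

lemma twoSidedField_le (hX : ∀ t, 0 < t → Measurable (X t)) (s u : ℝ) :
    twoSidedField X s u ≤ mΩ :=
  iSup₂_le fun t ht => (hX t ht.1).comap_le

lemma pastField_le_twoSidedField (s u : ℝ) : pastField X s ≤ twoSidedField X s u :=
  biSup_mono fun _ ht => ⟨ht.1, Or.inl ht.2⟩

lemma pastField_mono {s t : ℝ} (hst : s ≤ t) : pastField X s ≤ pastField X t :=
  biSup_mono fun _ hr => ⟨hr.1, hr.2.trans hst⟩

lemma measurable_pastField {t : ℝ} (ht : 0 < t) : Measurable[pastField X t] (X t) :=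
  measurable_iff_comap_le.2 <|
    le_iSup₂ (f := fun r (_ : r ∈ {r : ℝ | 0 < r ∧ r ≤ t}) => MeasurableSpace.comap (X r) inferInstance)
      t ⟨ht, le_rfl⟩

lemma measurable_twoSidedField_right {s u : ℝ} (hu : 0 < u) :
    Measurable[twoSidedField X s u] (X u) :=
  measurable_iff_comap_le.2 <|
    le_iSup₂ (f := fun r (_ : r ∈ {r : ℝ | 0 < r ∧ (r ≤ s ∨ u ≤ r)}) =>
      MeasurableSpace.comap (X r) inferInstance) u ⟨hu, Or.inr le_rfl⟩

end Fields

/-! ### The processes `p_n(X_t; t)`. -/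

namespace JacobiPencil

/-- The process `p_n(X_t; t)`. -/
noncomputable def proc {Ω : Type*} (J : JacobiPencil) (X : ℝ → Ω → ℝ) (n : ℕ) (t : ℝ) (ω : Ω) : ℝ :=
  (J.poly t n).eval (X t ω)

/-- The process `p_n(X_t; t)` is a martingale. -/
def IsMartingaleIndex {Ω : Type*} [MeasurableSpace Ω] (J : JacobiPencil) (μ : Measure Ω)
    (X : ℝ → Ω → ℝ) (n : ℕ) : Prop :=
  ∀ s t, 0 < s → s < t → μ[J.proc X n t | pastField X s] =ᵐ[μ] J.proc X n s

/-- The algebraic properties of the pencil that make its polynomials orthogonal martingale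
polynomials of a quadratic harness. -/
structure IsAdmissible (J : JacobiPencil) (q η θ σ τ : ℝ) : Prop where
  qCommutes : J.QCommutes q η θ σ τ
  a_ne : ∀ t, 0 < t → ∀ n, J.a t n ≠ 0
  a₀_ne : ∀ n, J.a₀ n ≠ 0
  c₁_zero : J.c₁ 0 = 0
  c₀_zero : J.c₀ 0 = 0
  c₀_one : J.c₀ 1 = 0
  a₁_zero : J.a₁ 0 = 0
  a₀_zero : J.a₀ 0 = 1
  b₁_zero : J.b₁ 0 = 0
  b₀_zero : J.b₀ 0 = 0
  det_ne : ∀ s, 0 < s → ∀ n, J.a₀ n * (1 + σ * s) - J.a₁ n * (τ - q * s) ≠ 0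
  denom_pos : ∀ s u, 0 < s → s < u → 0 < u * (1 + σ * s) + τ - q * s

variable {Ω : Type*} {mΩ : MeasurableSpace Ω} {μ : Measure Ω} {X : ℝ → Ω → ℝ}
  {q η θ σ τ : ℝ} {J : JacobiPencil}

lemma IsAdmissible.c_zero (hJ : J.IsAdmissible q η θ σ τ) (t : ℝ) : J.c t 0 = 0 := by
  simp [c, hJ.c₁_zero, hJ.c₀_zero]

lemma IsAdmissible.poly_one (hJ : J.IsAdmissible q η θ σ τ) (t : ℝ) :
    J.poly t 1 = Polynomial.X := by
  simp [poly, a, b, hJ.a₁_zero, hJ.a₀_zero, hJ.b₁_zero, hJ.b₀_zero]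

lemma IsAdmissible.mul_proc (hJ : J.IsAdmissible q η θ σ τ) {t : ℝ} (ht : 0 < t) (n : ℕ) (ω : Ω) :
    X t ω * J.proc X n t ω = J.mat t (fun k => J.proc X k t ω) n :=
  mul_eval_poly (hJ.a_ne t ht) (hJ.c_zero t) _ _

lemma proc_zero (t : ℝ) : J.proc X 0 t = fun _ => 1 := by
  ext ω; simp [proc, poly]

lemma IsAdmissible.proc_one (hJ : J.IsAdmissible q η θ σ τ) (t : ℝ) : J.proc X 1 t = X t := by
  ext ω; simp [proc, hJ.poly_one]

lemma stronglyMeasurable_proc {m : MeasurableSpace Ω} {t : ℝ} (h : Measurable[m] (X t)) (n : ℕ) :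
    StronglyMeasurable[m] (J.proc X n t) :=
  ((Polynomial.continuous _).measurable.comp h).stronglyMeasurable

lemma hasAllMoments_proc [IsFiniteMeasure μ] {t : ℝ} (h : HasAllMoments (X t) μ) (n : ℕ) :
    HasAllMoments (J.proc X n t) μ :=
  h.eval _

lemma IsAdmissible.condExp_mul_proc [IsFiniteMeasure μ] (hJ : J.IsAdmissible q η θ σ τ) {t : ℝ}
    (ht : 0 < t) (h : HasAllMoments (X t) μ) {m : MeasurableSpace Ω} (n : ℕ) :
    μ[fun ω => X t ω * J.proc X n t ω | m]
      =ᵐ[μ] fun ω => J.mat t (fun j => (μ[J.proc X j t | m]) ω) n := by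
  simp_rw [hJ.mul_proc ht]
  exact condExp_tridiagonal (fun k => (hasAllMoments_proc h k).integrable) _ _ _ n

lemma IsAdmissible.condExp_sq_mul_proc [IsFiniteMeasure μ] (hJ : J.IsAdmissible q η θ σ τ) {t : ℝ}
    (ht : 0 < t) (h : HasAllMoments (X t) μ) {m : MeasurableSpace Ω} (n : ℕ) :
    μ[fun ω => X t ω ^ 2 * J.proc X n t ω | m]
      =ᵐ[μ] fun ω => J.mat t (J.mat t (fun j => (μ[J.proc X j t | m]) ω)) n := by
  have h1 : (fun ω => X t ω ^ 2 * J.proc X n t ω)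
      = fun ω => J.mat t (fun j => X t ω * J.proc X j t ω) n := by
    ext ω; rw [mat_mul_left, ← hJ.mul_proc ht]; ring
  rw [h1]
  have h2 := condExp_tridiagonal (m := m)
    (fun k => (h.mul (hasAllMoments_proc (J := J) h k)).integrable) (J.a t) (J.b t) (J.c t) n
  have h3 := fun k => hJ.condExp_mul_proc (m := m) ht h k
  filter_upwards [h2, h3 (n + 1), h3 n, h3 (n - 1)] with ω h2 e1 e2 e3
  refine h2.trans ?_
  simp only [tridiagonal, e1, e2, e3]
  rfl

/-- Multiplying a martingale by a past factor. -/
lemma IsMartingaleIndex.condExp_mul [IsFiniteMeasure μ] {n : ℕ} (hn : J.IsMartingaleIndex μ X n)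
    (hX : ∀ t, 0 < t → Measurable (X t)) {s t u : ℝ} (ht : 0 < t) (hst : s ≤ t) (htu : t < u)
    {Y : Ω → ℝ} (hY : StronglyMeasurable[pastField X t] Y) (hYm : HasAllMoments Y μ)
    (hu : HasAllMoments (X u) μ) :
    μ[fun ω => Y ω * J.proc X n u ω | pastField X s]
      =ᵐ[μ] μ[fun ω => Y ω * J.proc X n t ω | pastField X s] := by
  have h1 : μ[fun ω => Y ω * J.proc X n u ω | pastField X t]
      =ᵐ[μ] fun ω => Y ω * J.proc X n t ω := by
    refine (condExp_mul_of_stronglyMeasurable_left hY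
      (hYm.mul (hasAllMoments_proc hu n)).integrable (hasAllMoments_proc hu n).integrable).trans ?_
    filter_upwards [hn t u ht htu] with ω h
    rw [Pi.mul_apply, h]
  exact (condExp_condExp_of_le (pastField_mono hst) (pastField_le hX t)).symm.trans
    (condExp_congr_ae h1)

end JacobiPencil

lemma IsQuadraticHarness.integrable_mul {Ω : Type*} [MeasurableSpace Ω] {μ : Measure Ω}
    {X : ℝ → Ω → ℝ} {q η θ σ τ : ℝ} (hX : IsQuadraticHarness μ X q η θ σ τ) {s t : ℝ}
    (hs : 0 < s) (ht : 0 < t) : Integrable (fun ω => X s ω * X t ω) μ :=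
  (hX.memLp_two s hs).integrable_mul (hX.memLp_two t ht)

/-! ### The martingale property. -/

section Harness

variable {Ω : Type*} {mΩ : MeasurableSpace Ω} {μ : Measure Ω} [IsProbabilityMeasure μ]
  {X : ℝ → Ω → ℝ} {q η θ σ τ : ℝ} {J : JacobiPencil}

namespace IsQuadraticHarness

lemma integrable (hX : IsQuadraticHarness μ X q η θ σ τ) {t : ℝ} (ht : 0 < t) :
    Integrable (X t) μ := (hX.memLp_two t ht).integrable (by norm_num)

lemma condExp_sq (hX : IsQuadraticHarness μ X q η θ σ τ) {s t u : ℝ} (hs : 0 < s) (hst : s < t)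
    (htu : t < u) :
    μ[fun ω => X t ω ^ 2 | twoSidedField X s u] =ᵐ[μ] fun ω =>
      ((u - t) / (u - s) * X s ω + (t - s) / (u - s) * X u ω) ^ 2 + harnessF q σ τ t s u *
        (1 + η * ((u * X s ω - s * X u ω) / (u - s)) + θ * ((X u ω - X s ω) / (u - s))
          + σ * ((u * X s ω - s * X u ω) / (u - s)) ^ 2 + τ * ((X u ω - X s ω) / (u - s)) ^ 2
          - (1 - q) * ((X u ω - X s ω) / (u - s)) * ((u * X s ω - s * X u ω) / (u - s))) := by
  have h1 := condVar_ae_eq_condExp_sq_sub_sq_condExp (twoSidedField_le hX.measurable s u)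
    (hX.memLp_two t (hs.trans hst))
  filter_upwards [h1, hX.condExp_eq s t u hs hst htu, hX.condVar_eq s t u hs hst htu]
    with ω h1 h2 h3
  have h1' : (Var[X t; μ | twoSidedField X s u]) ω = (μ[fun ω => X t ω ^ 2 | twoSidedField X s u]) ω
    - (μ[X t | twoSidedField X s u]) ω ^ 2 := h1
  rw [h2, h3] at h1'
  simp only [harnessDelta, harnessDeltaTilde] at h1'
  linarith

/-- Integrate `2 c |d| ≤ c² + d²` with `d = X u - X s`, whose second moment is `c²`. -/
lemma integral_abs_sub_le (hX : IsQuadraticHarness μ X q η θ σ τ) {s u c : ℝ} (hs : 0 < s)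
    (hsu : s < u) (hc : 0 < c) (hcu : c ^ 2 = u - s) : ∫ ω, |X u ω - X s ω| ∂μ ≤ c := by
  have hu := hs.trans hsu
  have hi := ((hX.memLp_two u hu).sub (hX.memLp_two s hs))
  have hsq : ∫ ω, (X u ω - X s ω) ^ 2 ∂μ = u - s := by
    have : ∀ ω, (X u ω - X s ω) ^ 2 = X u ω * X u ω - 2 * (X u ω * X s ω) + X s ω * X s ω :=
      fun ω => by ring
    simp_rw [this]
    rw [integral_add, integral_sub, integral_const_mul, hX.cov_eq u u hu hu, hX.cov_eq u s hu hs,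
      hX.cov_eq s s hs hs, min_self, min_self, min_eq_right hsu.le]
    · ring
    · exact hX.integrable_mul hu hu
    · exact (hX.integrable_mul hu hs).const_mul 2
    · exact (hX.integrable_mul hu hu).sub ((hX.integrable_mul hu hs).const_mul 2)
    · exact hX.integrable_mul hs hs
  calc ∫ ω, |X u ω - X s ω| ∂μ ≤ ∫ ω, (c / 2 + (2 * c)⁻¹ * (X u ω - X s ω) ^ 2) ∂μ := by
        refine integral_mono (hi.integrable (by norm_num)).abs
          ((integrable_const _).add (hi.integrable_sq.const_mul _)) fun ω => ?_
        have : c / 2 + (2 * c)⁻¹ * (X u ω - X s ω) ^ 2 - |X u ω - X s ω|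
            = (2 * c)⁻¹ * (|X u ω - X s ω| - c) ^ 2 := by
          rw [← sq_abs (X u ω - X s ω)]; field_simp; ring
        have h0 : 0 ≤ (2 * c)⁻¹ * (|X u ω - X s ω| - c) ^ 2 := by positivity
        dsimp only
        linarith
    _ = c := by
        have hi2 : Integrable (fun ω => (X u ω - X s ω) ^ 2) μ := hi.integrable_sq
        rw [integral_add (integrable_const _) (hi2.const_mul _), integral_const_mul, hsq, ← hcu]
        simp
        field_simp
        ring

/-- Conditioning the linear regression on the past gives `E|E(X_t | F_{≤s}) - X_s| = (t - s)/(u - s)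
· E|E(X_u | F_{≤s}) - X_s| ≤ (t - s)/√(u - s)`, and `u` is arbitrarily large. -/
lemma condExp_pastField (hX : IsQuadraticHarness μ X q η θ σ τ) {s t : ℝ} (hs : 0 < s)
    (hst : s < t) : μ[X t | pastField X s] =ᵐ[μ] X s := by
  have hm := pastField_le hX.measurable s
  have hXs : μ[X s | pastField X s] = X s := condExp_of_stronglyMeasurable hm
    (measurable_pastField hs).stronglyMeasurable (hX.integrable hs)
  have hint : ∀ u, 0 < u → Integrable (fun ω => (μ[X u | pastField X s]) ω - X s ω) μ :=
    fun u hu => integrable_condExp.sub (hX.integrable hs)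
  have hlin : ∀ u, t < u → μ[X t | pastField X s] =ᵐ[μ]
      fun ω => (u - t) / (u - s) * X s ω + (t - s) / (u - s) * (μ[X u | pastField X s]) ω := by
    intro u htu
    have hu : 0 < u := by linarith
    have h1 := condExp_condExp_of_le (f := X t) (μ := μ) (pastField_le_twoSidedField (X := X) s u)
      (twoSidedField_le hX.measurable s u)
    have h2 := condExp_congr_ae (m := pastField X s) (hX.condExp_eq s t u hs hst htu)
    have h3 := condExp_lincomb_three (m := pastField X s) (hX.integrable hs) (hX.integrable hu)
      (integrable_const (μ := μ) (0 : ℝ)) ((u - t) / (u - s)) ((t - s) / (u - s)) 0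
    simp only [zero_mul, add_zero, hXs] at h3
    exact h1.symm.trans (h2.trans h3)
  have hbound : ∀ c, 0 < c → t - s < c ^ 2 →
      (∫ ω, |(μ[X t | pastField X s]) ω - X s ω| ∂μ) * c ≤ t - s := by
    intro c hc hct
    obtain ⟨u, hu⟩ : ∃ u, c ^ 2 = u - s := ⟨c ^ 2 + s, by ring⟩
    have htu : t < u := by linarith
    have hus : 0 < u - s := by linarith
    have h1 : ∫ ω, |(μ[X t | pastField X s]) ω - X s ω| ∂μ
        = (t - s) / (u - s) * ∫ ω, |(μ[X u | pastField X s]) ω - X s ω| ∂μ := by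
      rw [← integral_const_mul]
      refine integral_congr_ae ?_
      filter_upwards [hlin u htu] with ω h
      have hpos : 0 < (t - s) / (u - s) := div_pos (by linarith) hus
      rw [h, ← abs_of_pos hpos, ← abs_mul, abs_of_pos hpos]
      congr 1
      field_simp
      ring
    have h2 : ∫ ω, |(μ[X u | pastField X s]) ω - X s ω| ∂μ ≤ c := by
      refine le_trans (le_of_eq ?_) ((integral_abs_condExp_le (m := pastField X s)
        (X u - X s)).trans (hX.integral_abs_sub_le hs (hst.trans htu) hc hu))
      refine integral_congr_ae ?_
      filter_upwards [condExp_sub (hX.integrable (by linarith : 0 < u)) (hX.integrable hs)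
        (pastField X s)] with ω h
      rw [h, hXs, Pi.sub_apply]
    rw [h1, ← hu]
    calc _ ≤ (t - s) / c ^ 2 * c * c := by
            have : 0 ≤ (t - s) / c ^ 2 := div_nonneg (by linarith) (by positivity)
            gcongr
      _ = t - s := by field_simp
  have hzero : ∫ ω, |(μ[X t | pastField X s]) ω - X s ω| ∂μ = 0 := by
    refine le_antisymm (not_lt.1 fun hI => ?_) (integral_nonneg fun _ => abs_nonneg _)
    set I := ∫ ω, |(μ[X t | pastField X s]) ω - X s ω| ∂μ
    have hd : 0 < (t - s) / I := div_pos (by linarith) hI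
    -- This `c` satisfies both `c² > t - s` and `I c > t - s`, contradicting `hbound`.
    have := hbound ((t - s) / I + (t - s) + 1) (by linarith) (by nlinarith)
    have e : I * ((t - s) / I + (t - s) + 1) = (t - s) + I * (t - s + 1) := by
      field_simp; ring
    rw [mul_comm, mul_comm _ I, e] at this
    nlinarith
  rw [integral_eq_zero_iff_of_nonneg (fun _ => abs_nonneg _) (hint t (hs.trans hst)).abs] at hzero
  filter_upwards [hzero] with ω h
  exact sub_eq_zero.1 (abs_eq_zero.1 h)

end IsQuadraticHarness

namespace JacobiPencil

lemma isMartingaleIndex_zero (hX : IsQuadraticHarness μ X q η θ σ τ) :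
    J.IsMartingaleIndex μ X 0 := by
  intro s t _ _
  rw [proc_zero, proc_zero, condExp_const (pastField_le hX.measurable s)]

lemma IsAdmissible.isMartingaleIndex_one (hJ : J.IsAdmissible q η θ σ τ)
    (hX : IsQuadraticHarness μ X q η θ σ τ) : J.IsMartingaleIndex μ X 1 := by
  intro s t hs hst
  rw [hJ.proc_one, hJ.proc_one]
  exact hX.condExp_pastField hs hst

/-- A factor `X_t` raises the index by one and `X_t²` by two, so `X_t p_{k+1}` and `X_t² p_k` both
reach `k + 2` while the martingale property is used only up to `k + 1`. -/
lemma IsAdmissible.isMartingaleIndex_succ (hJ : J.IsAdmissible q η θ σ τ)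
    (hX : IsQuadraticHarness μ X q η θ σ τ) (hm : ∀ t, 0 < t → HasAllMoments (X t) μ) {k : ℕ}
    (ih : ∀ j ≤ k + 1, J.IsMartingaleIndex μ X j) : J.IsMartingaleIndex μ X (k + 2) := by
  intro s t hs hst
  obtain ⟨u, htu⟩ := exists_gt t
  have ht := hs.trans hst
  have hu := ht.trans htu
  have hXs := (measurable_pastField (X := X) hs).stronglyMeasurable
  have hXt := (measurable_pastField (X := X) ht).stronglyMeasurable
  have hD := hJ.denom_pos s u hs (hst.trans htu)
  obtain ⟨κ, hκ1, hκ2, hκ3⟩ := exists_secondMoment_coeffs q η θ σ τ hst htu hD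
  have hp : ∀ n, HasAllMoments (J.proc X n u) μ := hasAllMoments_proc (hm u hu)
  have hpm : ∀ n, StronglyMeasurable[twoSidedField X s u] (J.proc X n u) :=
    stronglyMeasurable_proc (measurable_twoSidedField_right hu)
  have hle := pastField_le_twoSidedField (X := X) s u
  have hle' := twoSidedField_le hX.measurable s u
  have pull : ∀ n, μ[fun ω => X s ω * J.proc X n u ω | pastField X s]
      =ᵐ[μ] fun ω => X s ω * (μ[J.proc X n u | pastField X s]) ω := fun n =>
    condExp_mul_of_stronglyMeasurable_left hXs ((hm s hs).mul (hp n)).integrable (hp n).integrable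
  have pull_sq : ∀ n, μ[fun ω => X s ω ^ 2 * J.proc X n u ω | pastField X s]
      =ᵐ[μ] fun ω => X s ω ^ 2 * (μ[J.proc X n u | pastField X s]) ω := fun n =>
    condExp_mul_of_stronglyMeasurable_left (hXs.pow 2) (((hm s hs).pow 2).mul (hp n)).integrable
      (hp n).integrable
  have pull_mul : ∀ n, μ[fun ω => X s ω * (X u ω * J.proc X n u ω) | pastField X s]
      =ᵐ[μ] fun ω => X s ω * (μ[fun ω => X u ω * J.proc X n u ω | pastField X s]) ω := fun n =>
    condExp_mul_of_stronglyMeasurable_left hXs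
      ((hm s hs).mul ((hm u hu).mul (hp n))).integrable ((hm u hu).mul (hp n)).integrable
  -- On the left, the martingale property from `t` to `u` replaces `p_{k+1}(X_u;u)` by
  -- `p_{k+1}(X_t;t)`; on the right, linear regression replaces `X_t`.
  have lin : (fun ω => J.mat t (fun j => (μ[J.proc X j t | pastField X s]) ω) (k + 1))
      =ᵐ[μ] fun ω => (u - t) / (u - s) * (X s ω * (μ[J.proc X (k + 1) u | pastField X s]) ω)
        + (t - s) / (u - s) * J.mat u (fun j => (μ[J.proc X j u | pastField X s]) ω) (k + 1) := by
    have e1 := hJ.condExp_mul_proc (m := pastField X s) ht (hm t ht) (k + 1)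
    have e2 := (ih (k + 1) le_rfl).condExp_mul hX.measurable ht hst.le htu hXt (hm t ht) (hm u hu)
    have e3 := condExp_mul_congr hle hle' (hX.condExp_eq s t u hs hst htu) (hpm (k + 1))
      ((hm t ht).mul (hp (k + 1))).integrable (hm t ht).integrable
    have e4 := condExp_lincomb_three (m := pastField X s) ((hm s hs).mul (hp (k + 1))).integrable
      ((hm u hu).mul (hp (k + 1))).integrable (integrable_const (μ := μ) (0 : ℝ))
      ((u - t) / (u - s)) ((t - s) / (u - s)) 0
    simp only [zero_mul, add_zero, ← mul_assoc] at e4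
    simp only [add_mul] at e3
    have e5 := hJ.condExp_mul_proc (m := pastField X s) hu (hm u hu) (k + 1)
    filter_upwards [e1, e2, e3, e4, e5, pull (k + 1)] with ω e1 e2 e3 e4 e5 e6
    rw [← e1, ← e2, e3, e4, e5, e6]
  have quad : (fun ω => J.mat t (J.mat t (fun j => (μ[J.proc X j t | pastField X s]) ω)) k)
      =ᵐ[μ] fun ω => κ 0 * (X s ω ^ 2 * (μ[J.proc X k u | pastField X s]) ω)
        + κ 1 * (X s ω * J.mat u (fun j => (μ[J.proc X j u | pastField X s]) ω) k)
        + κ 2 * J.mat u (J.mat u (fun j => (μ[J.proc X j u | pastField X s]) ω)) k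
        + κ 3 * (X s ω * (μ[J.proc X k u | pastField X s]) ω)
        + κ 4 * J.mat u (fun j => (μ[J.proc X j u | pastField X s]) ω) k
        + κ 5 * (μ[J.proc X k u | pastField X s]) ω := by
    have e1 := hJ.condExp_sq_mul_proc (m := pastField X s) ht (hm t ht) k
    have e2 := (ih k (by omega)).condExp_mul hX.measurable ht hst.le htu
      (Y := fun ω => X t ω ^ 2) (hXt.pow 2)
      ((hm t ht).pow 2) (hm u hu)
    have e3 := condExp_mul_congr hle hle' (hX.condExp_sq hs hst htu) (hpm k)
      (((hm t ht).pow 2).mul (hp k)).integrable ((hm t ht).pow 2).integrable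
    simp only [hκ1] at e3
    have i0 := (((hm s hs).pow 2).mul (hp k)).integrable
    have i1 := ((hm s hs).mul ((hm u hu).mul (hp k))).integrable
    have i2 := (((hm u hu).pow 2).mul (hp k)).integrable
    have i3 := ((hm s hs).mul (hp k)).integrable
    have i4 := ((hm u hu).mul (hp k)).integrable
    have i5 := (hp k).integrable
    have e4 := condExp_lincomb_three (m := pastField X s) i0 i1 i2 (κ 0) (κ 1) (κ 2)
    have e5 := condExp_lincomb_three (m := pastField X s) i3 i4 i5 (κ 3) (κ 4) (κ 5)
    have e6 := condExp_add (((i0.const_mul (κ 0)).add (i1.const_mul (κ 1))).add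
      (i2.const_mul (κ 2))) (((i3.const_mul (κ 3)).add (i4.const_mul (κ 4))).add
      (i5.const_mul (κ 5))) (pastField X s)
    have e7 := hJ.condExp_mul_proc (m := pastField X s) hu (hm u hu) k
    have e8 := hJ.condExp_sq_mul_proc (m := pastField X s) hu (hm u hu) k
    have hfun : (fun ω => (κ 0 * X s ω ^ 2 + κ 1 * (X s ω * X u ω) + κ 2 * X u ω ^ 2 + κ 3 * X s ω
        + κ 4 * X u ω + κ 5) * J.proc X k u ω)
        = (fun ω => κ 0 * (X s ω ^ 2 * J.proc X k u ω)
            + κ 1 * (X s ω * (X u ω * J.proc X k u ω)) + κ 2 * (X u ω ^ 2 * J.proc X k u ω))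
          + fun ω => κ 3 * (X s ω * J.proc X k u ω) + κ 4 * (X u ω * J.proc X k u ω)
            + κ 5 * J.proc X k u ω := by
      ext ω; simp only [Pi.add_apply]; ring
    rw [hfun] at e3
    filter_upwards [e1, e2, e3, e4, e5, e6, e7, e8, pull k, pull_sq k, pull_mul k]
      with ω e1 e2 e3 e4 e5 e6 e7 e8 p1 p2 p3
    have e6' := e6.trans (congrArg₂ (· + ·) e4 e5)
    rw [p1, p2, p3, e7, e8] at e6'
    rw [← e1, ← e2, e3]
    refine e6'.trans ?_
    ring
  have hGt : ∀ᵐ ω ∂μ, ∀ j ≤ k + 1, (μ[J.proc X j t | pastField X s]) ω = J.proc X j s ω := by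
    rw [ae_all_iff]; intro j
    by_cases hj : j ≤ k + 1
    · filter_upwards [ih j hj s t hs hst] with ω h _ using h
    · exact ae_of_all _ fun _ h => absurd h hj
  have hGu : ∀ᵐ ω ∂μ, ∀ j ≤ k + 1, (μ[J.proc X j u | pastField X s]) ω = J.proc X j s ω := by
    rw [ae_all_iff]; intro j
    by_cases hj : j ≤ k + 1
    · filter_upwards [ih j hj s u hs (hst.trans htu)] with ω h _ using h
    · exact ae_of_all _ fun _ h => absurd h hj
  filter_upwards [lin, quad, hGt, hGu] with ω h1 h2 h3 h4
  rw [h4 _ le_rfl] at h1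
  rw [h4 k (by omega)] at h2
  exact eq_succ_of_harness_relations (v := X s ω) (P := fun j => J.proc X j s ω) hst htu
    (hJ.qCommutes |> hκ2 J) hκ3 (hJ.mul_proc hs · ω) h3 h4 (hJ.a_ne t ht _)
    (hJ.det_ne s hs k) h1 h2

lemma IsAdmissible.isMartingaleIndex (hJ : J.IsAdmissible q η θ σ τ)
    (hX : IsQuadraticHarness μ X q η θ σ τ) (hm : ∀ t, 0 < t → HasAllMoments (X t) μ) (n : ℕ) :
    J.IsMartingaleIndex μ X n := by
  induction n using Nat.strong_induction_on with
  | _ n ih =>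
    rcases n with _ | _ | n
    · exact isMartingaleIndex_zero hX
    · exact hJ.isMartingaleIndex_one hX
    · exact hJ.isMartingaleIndex_succ hX hm fun j hj => ih j (by omega)

end JacobiPencil

end Harness

/-! ### Orthogonality. -/

lemma integral_lincomb_three {Ω : Type*} {mΩ : MeasurableSpace Ω} {μ : Measure Ω} {f g h : Ω → ℝ}
    (hf : Integrable f μ) (hg : Integrable g μ) (hh : Integrable h μ) (a b c : ℝ) :
    ∫ ω, (a * f ω + b * g ω + c * h ω) ∂μ
      = a * ∫ ω, f ω ∂μ + b * ∫ ω, g ω ∂μ + c * ∫ ω, h ω ∂μ := by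
  have hfg : Integrable (fun ω => a * f ω + b * g ω) μ := (hf.const_mul a).add (hg.const_mul b)
  rw [integral_add hfg (hh.const_mul c), integral_add (hf.const_mul a) (hg.const_mul b),
    integral_const_mul, integral_const_mul, integral_const_mul]

section Orthogonality

variable {Ω : Type*} {mΩ : MeasurableSpace Ω} {μ : Measure Ω} [IsProbabilityMeasure μ]
  {X : ℝ → Ω → ℝ} {q η θ σ τ : ℝ} {J : JacobiPencil}

namespace JacobiPencil

/-- Since `E X_s² = s` tends to `0` with `s`, the expectations of the martingales `p_n(X_t; t)` are
annihilated by `y`. -/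
lemma IsAdmissible.y_integral_proc (hJ : J.IsAdmissible q η θ σ τ)
    (hX : IsQuadraticHarness μ X q η θ σ τ) (hm : ∀ t, 0 < t → HasAllMoments (X t) μ) {t : ℝ}
    (ht : 0 < t) (n : ℕ) : J.y (fun k => ∫ ω, J.proc X k t ω ∂μ) n = 0 := by
  set e : ℕ → ℝ := fun k => ∫ ω, J.proc X k t ω ∂μ with he
  have hmart := hJ.isMartingaleIndex hX hm
  have he' : ∀ s, 0 < s → s < t → ∀ k, ∫ ω, J.proc X k s ω ∂μ = e k := by
    intro s hs hst k
    change _ = ∫ ω, J.proc X k t ω ∂μ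
    rw [← integral_condExp (pastField_le hX.measurable s) (f := J.proc X k t)]
    exact (integral_congr_ae (hmart k s t hs hst)).symm
  have hp := hasAllMoments_proc (J := J) (hm t ht) n
  have hcross : ∀ s, 0 < s → s < t → ∫ ω, X s ω * J.proc X n t ω ∂μ = J.mat s e n := by
    intro s hs hst
    have h1 := (hmart n).condExp_mul hX.measurable hs le_rfl hst
      (measurable_pastField hs).stronglyMeasurable (hm s hs) (hm t ht)
    have hle := pastField_le hX.measurable s
    rw [← integral_condExp hle, integral_congr_ae h1, integral_condExp hle]
    have hi : ∀ k, Integrable (J.proc X k s) μ := fun k => (hasAllMoments_proc (hm s hs) k).integrable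
    simp_rw [hJ.mul_proc hs, mat, tridiagonal]
    rw [integral_lincomb_three (hi _) (hi _) (hi _), he' s hs hst, he' s hs hst, he' s hs hst]
  set K := ∫ ω, J.proc X n t ω * J.proc X n t ω ∂μ with hK
  have hK0 : 0 ≤ K := integral_nonneg fun ω => mul_self_nonneg _
  -- Expand `E(X_s - r p_n(X_t;t))² ≥ 0`; only terms in `r` survive as `s → 0`.
  have hquad : ∀ r s, 0 < s → s < t → 0 ≤ s - 2 * r * J.mat s e n + r ^ 2 * K := by
    intro r s hs hst
    have h0 : 0 ≤ ∫ ω, (X s ω - r * J.proc X n t ω) ^ 2 ∂μ := integral_nonneg fun ω => sq_nonneg _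
    have hexp : ∀ ω, (X s ω - r * J.proc X n t ω) ^ 2 = 1 * (X s ω * X s ω)
        + -(2 * r) * (X s ω * J.proc X n t ω) + r ^ 2 * (J.proc X n t ω * J.proc X n t ω) :=
      fun ω => by ring
    simp_rw [hexp] at h0
    rw [integral_lincomb_three ((hm s hs).mul (hm s hs)).integrable ((hm s hs).mul hp).integrable
      (hp.mul hp).integrable, hX.cov_eq s s hs hs, min_self, hcross s hs hst] at h0
    linarith
  have hlim : ∀ r, 0 ≤ -(2 * r * J.y e n) + r ^ 2 * K := by
    intro r
    have hc : Continuous fun s : ℝ => s - 2 * r * (s * J.x e n + J.y e n) + r ^ 2 * K := by fun_prop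
    have hT := (hc.tendsto 0).mono_left (nhdsWithin_le_nhds (s := Set.Ioi 0))
    have := ge_of_tendsto hT (b := 0) (by
      filter_upwards [Ioo_mem_nhdsGT ht] with s hs
      simpa [mat_apply] using hquad r s hs.1 hs.2)
    simpa using this
  -- This `r` makes the bound negative unless `y e` vanishes at `n`; `K + 1` avoids division by
  -- zero.
  have hr := hlim (J.y e n / (K + 1))
  have hK1 : 0 < K + 1 := by linarith
  have e1 : -(2 * (J.y e n / (K + 1)) * J.y e n) + (J.y e n / (K + 1)) ^ 2 * K
      = -(J.y e n ^ 2 * (K + 2) / (K + 1) ^ 2) := by field_simp; ring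
  rw [e1] at hr
  have h2 : 0 ≤ J.y e n ^ 2 * (K + 2) / (K + 1) ^ 2 := by positivity
  have h3 : J.y e n ^ 2 * (K + 2) / (K + 1) ^ 2 = 0 := by linarith
  have h4 : J.y e n ^ 2 * (K + 2) = 0 := (div_eq_zero_iff.1 h3).resolve_right (by positivity)
  exact pow_eq_zero_iff (two_ne_zero) |>.1 ((mul_eq_zero.1 h4).resolve_right (by linarith))

lemma IsAdmissible.integral_proc (hJ : J.IsAdmissible q η θ σ τ)
    (hX : IsQuadraticHarness μ X q η θ σ τ) (hm : ∀ t, 0 < t → HasAllMoments (X t) μ) {t : ℝ}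
    (ht : 0 < t) {n : ℕ} (hn : 0 < n) : ∫ ω, J.proc X n t ω ∂μ = 0 :=
  eq_zero_of_y_eq_zero (e := fun n => ∫ ω, J.proc X n t ω ∂μ) hJ.b₀_zero hJ.c₀_zero hJ.c₀_one
    hJ.a₀_ne (hJ.y_integral_proc hX hm ht) n hn

/-- `E(X_t p_k p_l)` can be expanded in either index, so `J.mat t` acts in the same way on rows and
columns of the Gram matrix, whose row `0` is known. -/
lemma IsAdmissible.integral_proc_mul_proc (hJ : J.IsAdmissible q η θ σ τ)
    (hX : IsQuadraticHarness μ X q η θ σ τ) (hm : ∀ t, 0 < t → HasAllMoments (X t) μ) {t : ℝ}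
    (ht : 0 < t) {m n : ℕ} (hmn : m < n) :
    ∫ ω, J.proc X m t ω * J.proc X n t ω ∂μ = 0 := by
  have hi : ∀ k l, Integrable (fun ω => J.proc X k t ω * J.proc X l t ω) μ := fun k l =>
    ((hasAllMoments_proc (hm t ht) k).mul (hasAllMoments_proc (hm t ht) l)).integrable
  have hmat : ∀ k l, ∫ ω, J.proc X k t ω * (X t ω * J.proc X l t ω) ∂μ
      = J.mat t (fun j => ∫ ω, J.proc X k t ω * J.proc X j t ω ∂μ) l := by
    intro k l
    have h1 : ∀ ω, J.proc X k t ω * (X t ω * J.proc X l t ω)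
        = J.a t l * (J.proc X k t ω * J.proc X (l + 1) t ω)
          + J.b t l * (J.proc X k t ω * J.proc X l t ω)
          + J.c t l * (J.proc X k t ω * J.proc X (l - 1) t ω) := by
      intro ω; rw [hJ.mul_proc ht, mat, tridiagonal]; ring
    simp_rw [h1]
    exact integral_lincomb_three (hi _ _) (hi _ _) (hi _ _) _ _ _
  refine gram_eq_zero (M := fun k l => ∫ ω, J.proc X k t ω * J.proc X l t ω ∂μ) (hJ.a_ne t ht)
    (fun k hk => ?_) (fun k l => ?_) m n hmn
  · simpa [proc_zero] using hJ.integral_proc hX hm ht hk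
  · have h2 := hmat k l
    have h3 := hmat l k
    rw [← h2]
    simp_rw [mul_comm (J.proc X _ t _) (J.proc X l t _)]
    rw [← h3]
    exact integral_congr_ae (ae_of_all _ fun ω => by ring)

end JacobiPencil

/-- A nonzero polynomial does not vanish almost surely on a variable of infinite support. -/
lemma integral_eval_sq_pos {Y : Ω → ℝ} (hY : Measurable Y) (hYm : HasAllMoments Y μ)
    (hsupp : (μ.map Y).support.Infinite) {p : ℝ[X]} (hp : p ≠ 0) :
    0 < ∫ ω, p.eval (Y ω) ^ 2 ∂μ := by
  refine (integral_nonneg fun ω => sq_nonneg _).lt_of_ne' fun h => hsupp ?_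
  rw [integral_eq_zero_iff_of_nonneg (fun ω => sq_nonneg _) ((hYm.eval p).pow 2).integrable] at h
  have hfin : {x : ℝ | p.IsRoot x}.Finite := Polynomial.finite_setOfPred_isRoot hp
  refine hfin.subset (Measure.support_subset_of_isClosed hfin.isClosed ?_)
  rw [mem_ae_map_iff hY.aemeasurable hfin.measurableSet]
  filter_upwards [h] with ω hω
  exact pow_eq_zero_iff two_ne_zero |>.1 hω

lemma JacobiPencil.IsAdmissible.isOrthogonalMartingalePolynomials
    (hJ : J.IsAdmissible q η θ σ τ) (hX : IsQuadraticHarness μ X q η θ σ τ)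
    (hm : ∀ t, 0 < t → HasAllMoments (X t) μ)
    (hsupp : ∀ t, 0 < t → (μ.map (X t)).support.Infinite) :
    IsOrthogonalMartingalePolynomials μ X fun n t => J.poly t n where
  degree_eq n t ht := degree_poly (hJ.a_ne t ht) n
  integrable n t ht := (hasAllMoments_proc (J := J) (hm t ht) n).integrable
  integrable_mul m n t ht :=
    ((hasAllMoments_proc (J := J) (hm t ht) m).mul (hasAllMoments_proc (hm t ht) n)).integrable
  orthogonal m n t ht hmn := by
    rcases hmn.lt_or_gt with h | h
    · exact hJ.integral_proc_mul_proc hX hm ht h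
    · simp_rw [mul_comm (eval _ (J.poly t m))]
      exact hJ.integral_proc_mul_proc hX hm ht h
  norm_pos n t ht := integral_eval_sq_pos (hX.measurable t ht) (hm t ht) (hsupp t ht) fun h0 => by
    have := degree_poly (hJ.a_ne t ht) n
    simp [h0] at this
  martingale n s t hs hst := hJ.isMartingaleIndex hX hm n s t hs hst

end Orthogonality

/-! ### Admissibility of the explicit pencil, and conclusion. -/

lemma harnessPencil_isAdmissible {q η θ σ τ : ℝ} {α β γ δ ω : ℕ → ℝ}
    (hσ : 0 ≤ σ) (hτ : 0 ≤ τ) (hq1 : q ≤ 1)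
    (hα0 : α 0 = 0) (hβ0 : β 0 = 0) (hα1 : α 1 = 0) (hβ1 : β 1 = 1)
    (hγ0 : γ 0 = 0) (hδ0 : δ 0 = 0)
    (hα : ∀ n, 1 ≤ n → α (n + 1) = q * α n + β n)
    (hβ : ∀ n, 1 ≤ n → β (n + 1) = -(σ * τ) * α n + β n)
    (hαnn : ∀ n, 1 ≤ n → 0 ≤ α n) (hβpos : ∀ n, 1 ≤ n → 0 < β n)
    (hcomm : (harnessPencil σ τ α β γ δ ω).QCommutes q η θ σ τ) :
    (harnessPencil σ τ α β γ δ ω).IsAdmissible q η θ σ τ where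
  qCommutes := hcomm
  a_ne t ht n := by
    have h1 := hαnn (n + 1) (by omega)
    have h2 := hβpos (n + 1) (by omega)
    simp only [JacobiPencil.a, harnessPencil]
    positivity
  a₀_ne n := (hβpos (n + 1) (by omega)).ne'
  c₁_zero := by simp [harnessPencil, hβ0]
  c₀_zero := by simp [harnessPencil, hα0]
  c₀_one := by simp [harnessPencil, hα1]
  a₁_zero := by simp [harnessPencil, hα1]
  a₀_zero := by simp [harnessPencil, hβ1]
  b₁_zero := hγ0
  b₀_zero := hδ0
  det_ne s hs n := by
    have h1 := hαnn (n + 2) (by omega)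
    have h2 := hβpos (n + 2) (by omega)
    -- The determinant is the next superdiagonal entry at time `s`.
    have : β (n + 1) * (1 + σ * s) - σ * α (n + 1) * (τ - q * s)
        = β (n + 2) + σ * s * α (n + 2) := by
      rw [hα (n + 1) (by omega), hβ (n + 1) (by omega)]; ring
    simp only [harnessPencil]
    rw [this]
    positivity
  denom_pos s u hs hsu := by
    have hu := hs.trans hsu
    have : 0 ≤ u * (σ * s) := by positivity
    -- The denominator is `(u - s) + (1 - q) s + σ s u + τ`.
    nlinarith [mul_nonneg (sub_nonneg.2 hq1) hs.le]

theorem theorem4p1 {Ω : Type*} [MeasurableSpace Ω] (μ : Measure Ω) [IsProbabilityMeasure μ]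
    (X : ℝ → Ω → ℝ) (q η θ σ τ : ℝ)
    (hσ : 0 ≤ σ) (hτ : 0 ≤ τ) (hστ : σ * τ < 1)
    (hq : -1 < q) (hq' : q ≤ 1 - 2 * Real.sqrt (σ * τ))
    (hX : IsQuadraticHarness μ X q η θ σ τ)
    (hmom : ∀ t, 0 < t → ∀ n : ℕ, Integrable (fun ω => X t ω ^ n) μ)
    (hsupp : ∀ t, 0 < t → (μ.map (X t)).support.Infinite) :
    ∃ α β γ δ ω : ℕ → ℝ,
      -- initial conditions
      (α 0 = 0 ∧ β 0 = 0 ∧ α 1 = 0 ∧ β 1 = 1 ∧ γ 0 = 0 ∧ δ 0 = 0 ∧ ω 1 = 1 ∧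
        ω 2 = (1 + q) * (((1 - σ * τ) ^ 2 + (η + θ * σ) * (θ + η * τ)) /
          ((1 - σ * τ) ^ 2 * (1 - σ * τ * (2 + q))))) ∧
      -- the recurrence for `α` and `β`
      (∀ n, 1 ≤ n →
        ![α (n + 1), β (n + 1)] = Matrix.mulVec !![q, 1; -(σ * τ), 1] ![α n, β n]) ∧
      (∀ n k, 1 ≤ n → 0 < lambdaCoeff σ τ α β n k) ∧
      -- the recurrences for `γ` and `δ`
      (∀ n,
        γ (n + 1) =
          (q + σ * τ) / lambdaCoeff σ τ α β (n + 2) 0 *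
            (lambdaCoeff σ τ α β n 2 * γ n
              + (α (n + 2) * β n - β (n + 2) * α n) * σ * δ n)
          + σ * α (n + 2) / lambdaCoeff σ τ α β (n + 2) 0 *
            (η * τ * α (n + 1) + θ * β (n + 1))
          + β (n + 2) / lambdaCoeff σ τ α β (n + 2) 0 *
            (θ * σ * α (n + 1) + η * β (n + 1))) ∧
      (∀ n,
        δ (n + 1) =
          (q + σ * τ) / lambdaCoeff σ τ α β (n + 2) 0 *
            (lambdaCoeff σ τ α β n 2 * δ n
              + (α (n + 2) * β n - β (n + 2) * α n) * τ * γ n)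
          + β (n + 2) / lambdaCoeff σ τ α β (n + 2) 0 *
            (η * τ * α (n + 1) + θ * β (n + 1))
          + τ * α (n + 2) / lambdaCoeff σ τ α β (n + 2) 0 *
            (θ * σ * α (n + 1) + η * β (n + 1))) ∧
      -- the recurrence for `ω`
      (∀ n, 2 ≤ n →
        ω (n + 1) =
          (q + σ * τ) * lambdaCoeff σ τ α β (n - 1) 1 / lambdaCoeff σ τ α β (n + 1) 1 * ω n
          + (1 + γ n * (τ * γ n - δ n + θ) + δ n * (q * γ n + σ * δ n + η)) /
            lambdaCoeff σ τ α β (n + 1) 1) ∧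
      -- the orthogonal martingale polynomials and their three step recurrence
      ∃ p : ℕ → ℝ → ℝ[X],
        IsOrthogonalMartingalePolynomials μ X p ∧
        (∀ t, 0 < t → p 0 t = 1 ∧ p 1 t = Polynomial.X) ∧
        (∀ t, 0 < t →
          Polynomial.X * p 0 t =
            C (σ * α 1 * t + β 1) * p 1 t + C (γ 0 * t + δ 0) * p 0 t) ∧
        (∀ n t, 1 ≤ n → 0 < t →
          Polynomial.X * p n t =
            C (σ * α (n + 1) * t + β (n + 1)) * p (n + 1) t
            + C (γ n * t + δ n) * p n t
            + C ((β n * t + τ * α n) * ω n) * p (n - 1) t) := by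
  obtain ⟨r, hrdef⟩ : ∃ r, r = Real.sqrt (σ * τ) := ⟨_, rfl⟩
  have hr : 0 ≤ r := hrdef ▸ Real.sqrt_nonneg _
  have hr2 : σ * τ = r ^ 2 := by rw [hrdef, Real.sq_sqrt (mul_nonneg hσ hτ)]
  have hr1 : r < 1 := by nlinarith
  rw [← hrdef] at hq'
  let α : ℕ → ℝ := fun n => (alphaBeta q (σ * τ) n).1
  let β : ℕ → ℝ := fun n => (alphaBeta q (σ * τ) n).2
  let γ : ℕ → ℝ := fun n => (gammaDelta q η θ σ τ α β n).1
  let δ : ℕ → ℝ := fun n => (gammaDelta q η θ σ τ α β n).2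
  let w : ℕ → ℝ := omegaSeq q η θ σ τ α β γ δ
  have hα : ∀ n, 1 ≤ n → α (n + 1) = q * α n + β n := by
    intro n hn
    obtain ⟨n, rfl⟩ := Nat.exists_eq_succ_of_ne_zero (by omega : n ≠ 0)
    rfl
  have hβ : ∀ n, 1 ≤ n → β (n + 1) = -(σ * τ) * α n + β n := by
    intro n hn
    obtain ⟨n, rfl⟩ := Nat.exists_eq_succ_of_ne_zero (by omega : n ≠ 0)
    rfl
  have hcone := alpha_nonneg_and_lt_beta hr hr1 hq hq' (α := α) (β := β) rfl rfl hα
    (by rwa [← hr2])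
  have hαnn : ∀ n, 1 ≤ n → 0 ≤ α n := fun n hn => (hcone n hn).1
  have hβpos : ∀ n, 1 ≤ n → 0 < β n := fun n hn =>
    beta_pos_of_lt hr (hcone n hn).1 (hcone n hn).2.2
  have hlam : ∀ n k, 1 ≤ n → 0 < lambdaCoeff σ τ α β n k :=
    lambdaCoeff_pos_of_lt hr hr2 fun n hn => ⟨(hcone n hn).1, (hcone n hn).2.2⟩
  have hω : ∀ n, 2 ≤ n → w (n + 1) =
      (q + σ * τ) * lambdaCoeff σ τ α β (n - 1) 1 / lambdaCoeff σ τ α β (n + 1) 1 * w n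
        + (1 + γ n * (τ * γ n - δ n + θ) + δ n * (q * γ n + σ * δ n + η)) /
          lambdaCoeff σ τ α β (n + 1) 1 := by
    intro n hn
    obtain ⟨m, rfl⟩ : ∃ m, n = m + 2 := ⟨n - 2, by omega⟩
    rfl
  have hγδ := gamma_delta_relations (γ := γ) (δ := δ) (η := η) (θ := θ) (rfl : α 0 = 0)
    (rfl : β 0 = 0) rfl rfl hα hβ (fun n => (hlam (n + 2) 0 (by omega)).ne') (fun _ => rfl)
    (fun _ => rfl)
  have hγδ0 : β 2 * γ 1 - σ * α 2 * δ 1 = η ∧ β 2 * δ 1 - τ * α 2 * γ 1 = θ := by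
    have h0 := hγδ 0
    have hα1 : α 1 = 0 := rfl
    have hβ1 : β 1 = 1 := rfl
    have hγ0 : γ 0 = 0 := rfl
    have hδ0 : δ 0 = 0 := rfl
    simpa only [zero_add, hα1, hβ1, hγ0, hδ0, mul_zero, zero_mul, add_zero, mul_one] using h0
  have hωrel := omega_relation (ω := w) (rfl : α 1 = 0) rfl rfl rfl hγδ0 hα hβ hστ.ne
    (fun n => (hlam (n + 2) 1 (by omega)).ne') hω
  have hJ := harnessPencil_isAdmissible hσ hτ (by linarith) rfl rfl rfl rfl rfl rfl hα hβ hαnn hβpos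
    (harnessPencil_qCommutes (ω := w) (rfl : α 0 = 0) rfl rfl rfl (rfl : γ 0 = 0) rfl rfl hα hβ
      hγδ hωrel)
  have hm : ∀ t, 0 < t → HasAllMoments (X t) μ := fun t ht =>
    HasAllMoments.of_integrable_pow (hX.measurable t ht).aestronglyMeasurable (hmom t ht)
  refine ⟨α, β, γ, δ, w, ⟨rfl, rfl, rfl, rfl, rfl, rfl, rfl, rfl⟩, fun n hn => ?_, hlam,
    fun _ => rfl, fun _ => rfl, hω, fun n t => (harnessPencil σ τ α β γ δ w).poly t n,
    hJ.isOrthogonalMartingalePolynomials hX hm hsupp,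
    fun t _ => ⟨rfl, hJ.poly_one t⟩, fun t ht => JacobiPencil.X_mul_poly_zero (hJ.a_ne t ht 0),
    fun n t hn ht => ?_⟩
  · rw [hα n hn, hβ n hn]
    ext i
    fin_cases i <;> simp [Matrix.mulVec, dotProduct, Fin.sum_univ_two]
  · obtain ⟨n, rfl⟩ := Nat.exists_eq_succ_of_ne_zero (by omega : n ≠ 0)
    refine (JacobiPencil.X_mul_poly_succ (hJ.a_ne t ht (n + 1))).trans ?_
    congr 3
    simp only [JacobiPencil.c, harnessPencil]
    ring
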